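/- Let $K$ be a separable complex Hilbert space and $H = K\otimes L^2(0,\infty)$, identified with the space of square integrable $K$-valued functions on $(0,\infty)$. Let $B(\cdot)_*$ denote the space of normal (σ-weakly continuous) functionals on $B(\cdot)$. For $t>0$ let $S_t$ be the right shift on $H$ and $E(t,\infty)=S_tS_t^*$. Define $\Lambda:B(K)\to B(H)$ by $(\Lambda(A)f)(x)=e^{-x}Af(x)$, with predual map $\hat\Lambda:B(H)_*\to B(K)_*$, $\hat\Lambda\eta=\eta\circ\Lambda$. Put $\mathfrak A(H)=(I-\Lambda(I))^{1/2}B(H)(I-\Lambda(I))^{1/2}$, and let $\mathfrak A(H)_*$ be the set of linear functionals $\mu$ on $\mathfrak A(H)$ such that $A\mapsto \mu\big((I-\Lambda(I))^{1/2}A(I-\Lambda(I))^{1/2}\big)$ is a normal bounded functional on $B(H)$. A *$q$-weight map* over $K$ is a completely positive linear map $\omega:B(K)_*\to\mathfrak A(H)_*$ with $\omega(\rho)(I-\Lambda(I))\le\rho(I)$ for all positive $\rho$ such that, for every $t>0$, with $\omega|_t(\rho)(A)=\omega(\rho)(E(t,\infty)AE(t,\infty))$, the map $I+\hat\Lambda\,\omega|_t$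 on $B(K)_*$ is invertible and $\hat\pi_t=\omega|_t(I+\hat\Lambda\,\omega|_t)^{-1}:B(K)_*\to B(H)_*$ is a completely positive contraction. Its *generalized boundary representation* is the family of dual maps $\Pi_t^\#:B(H)\to B(K)$, $\rho(\Pi_t^\#(A))=\hat\pi_t(\rho)(A)$, and its *dualized map* is the linear map $\breve\omega:\mathfrak A(H)\to B(K)$ with $\rho(\breve\omega(T))=\omega(\rho)(T)$. Its *normal spine* is the σ-weakly continuous linear map $\Pi_0^\#:B(H)\to B(K)$ such that $\Pi_s^\#(T)\to\Pi_0^\#(T)$ σ-strongly as $s\to0+$ for every $T\in\bigcup_{t>0}S_tB(H)S_t^*$. Let $\mathfrak C(B(K))$ be the set of bounded linear maps $\phi:B(K)\to B(K)$ with $\|\phi\|\le1$, with the relative BW-topology, in which $\phi_\lambda\to\phi$ if and only if $\rho(\phi_\lambda(x))\to\rho(\phi(x))$ for all $x\in B(K)$ and $\rho\in B(K)_*$. A *boundary expectation* for $\omega$ is a map $L:B(K)\to B(K)$ such that (i) $L$ is linear and completely positive; (ii) $L\circ\breve\omega=\breve\omega$; (iii) $\operatorname{range}(L)=\operatorname{range}(\breve\omega)$;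 (iv) $L^2=L$ and $\|L\|=1$. **Theorem.** Let $\omega$ be a non-zero $q$-weight map over $K$ such that $\operatorname{range}(\breve\omega)$ is finite-dimensional and whose normal spine is $\Pi_0^\#=0$. Then the net $(\Pi_t^\#\circ\Lambda)_{t>0}$ in $\mathfrak C(B(K))$, directed by decreasing $t$ (that is, $t\to0+$), has at least one cluster point in the relative BW-topology, and every such cluster point is a boundary expectation for $\omega$. -/

import Mathlib

open MeasureTheory Filter Topology
open scoped ENNReal ComplexOrder

set_option linter.unusedSectionVars false

noncomputable section

namespace QWeight

/-! ### Normal functionals -/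

section Normal

variable (H : Type*) [NormedAddCommGroup H] [InnerProductSpace ℂ H]

/-- The algebra of bounded operators on a Hilbert space. -/
abbrev Op : Type _ := H →L[ℂ] H

variable {H} in
/-- The vector functional `A ↦ ⟪x, A y⟫`. -/
def vectorFunctional (x y : H) : Op H →L[ℂ] ℂ :=
  (innerSL ℂ x) ∘L (ContinuousLinearMap.apply ℂ H y)

/-- Subspaces of a normed space. -/
abbrev Subspc (E : Type*) [NormedAddCommGroup E] [NormedSpace ℂ E] : Type _ := Submodule ℂ E

/-- The normal (σ-weakly continuous) functionals on `B(H)`, that is, the norm-closed linear span of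
the vector functionals in the dual of `B(H)`. -/
def normalFunctionals : Subspc (Op H →L[ℂ] ℂ) :=
  (Submodule.span ℂ (Set.range fun p : H × H => vectorFunctional p.1 p.2)).topologicalClosure

/-- The predual `B(H)_*`: the normed space of normal functionals, with the norm of the dual
of `B(H)`. -/
def Predual : Type _ := normalFunctionals H

instance : NormedAddCommGroup (Predual H) :=
  Submodule.normedAddCommGroup (normalFunctionals H)

instance : NormedSpace ℂ (Predual H) := Submodule.normedSpace (normalFunctionals H)

variable {H} in
/-- The inclusion of `B(H)_*` into the dual of `B(H)`. -/
def Predual.toDual : Predual H →ₗ[ℂ] (Op H →L[ℂ] ℂ) := (normalFunctionals H).subtype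

instance : CoeFun (Predual H) fun _ => Op H → ℂ := ⟨fun ρ => Predual.toDual ρ⟩

variable {H} in
/-- A normal functional as an element of `B(H)_*`. -/
def Predual.mk (f : Op H →L[ℂ] ℂ) (hf : f ∈ normalFunctionals H) : Predual H := ⟨f, hf⟩

variable {H} in
theorem Predual.toDual_mk (f : Op H →L[ℂ] ℂ) (hf : f ∈ normalFunctionals H) :
    Predual.toDual (Predual.mk f hf) = f := rfl

variable {H} in
theorem Predual.toDual_mem (ρ : Predual H) : Predual.toDual ρ ∈ normalFunctionals H := ρ.2

variable {H} in
theorem Predual.ext {ρ σ : Predual H} (h : ∀ A, ρ A = σ A) : ρ = σ :=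
  Subtype.ext (ContinuousLinearMap.ext h)

variable {H} in
theorem Predual.norm_toDual (ρ : Predual H) : ‖Predual.toDual ρ‖ = ‖ρ‖ := rfl

end Normal

section Normal

variable {H K : Type*} [NormedAddCommGroup H] [InnerProductSpace ℂ H]
  [NormedAddCommGroup K] [InnerProductSpace ℂ K]

theorem vectorFunctional_mem (x y : H) : vectorFunctional x y ∈ normalFunctionals H :=
  Submodule.le_topologicalClosure _ (Submodule.subset_span ⟨(x, y), rfl⟩)

theorem comp_mem_predual (T : Op K →L[ℂ] Op H)
    (hT : ∀ x y : H, (vectorFunctional x y) ∘L T ∈ normalFunctionals K) (η : Op H →L[ℂ] ℂ)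
    (hη : η ∈ normalFunctionals H) : η ∘L T ∈ normalFunctionals K := by
  let Φ : (Op H →L[ℂ] ℂ) →L[ℂ] (Op K →L[ℂ] ℂ) :=
    (ContinuousLinearMap.compL ℂ (Op K) (Op H) ℂ).flip T
  have hc : IsClosed ((normalFunctionals K).comap (Φ : (Op H →L[ℂ] ℂ) →ₗ[ℂ] (Op K →L[ℂ] ℂ)) :
      Set (Op H →L[ℂ] ℂ)) :=
    (Submodule.isClosed_topologicalClosure _).preimage Φ.continuous
  have hle : normalFunctionals H ≤
      (normalFunctionals K).comap (Φ : (Op H →L[ℂ] ℂ) →ₗ[ℂ] (Op K →L[ℂ] ℂ)) := by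
    refine Submodule.topologicalClosure_minimal _ ?_ hc
    rw [Submodule.span_le]
    rintro _ ⟨p, rfl⟩
    exact hT p.1 p.2
  exact hle hη

/-- The predual map `η ↦ η ∘ T` of a normal map `T : B(K) → B(H)`. -/
def preadjoint (T : Op K →L[ℂ] Op H)
    (hT : ∀ x y : H, (vectorFunctional x y) ∘L T ∈ normalFunctionals K) :
    Predual H →ₗ[ℂ] Predual K where
  toFun η := Predual.mk (Predual.toDual η ∘L T)
    (comp_mem_predual T hT (Predual.toDual η) η.toDual_mem)
  map_add' _ _ := rfl
  map_smul' _ _ := rfl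

/-- The positive square root of a positive operator. -/
def posSqrt [CompleteSpace H] (A : Op H) : Op H := CFC.sqrt A

theorem posSqrt_eq [CompleteSpace H] {A B : Op H} (h : B * B = A) (hB : 0 ≤ B) :
    posSqrt A = B := CFC.sqrt_unique h hB

theorem star_posSqrt [CompleteSpace H] (A : Op H) : star (posSqrt A) = posSqrt A :=
  (CFC.sqrt_nonneg A).isSelfAdjoint

/-- The map `A ↦ X A Y` on `B(H)`. -/
def sandwich (X Y : Op H) : Op H →L[ℂ] Op H :=
  (ContinuousLinearMap.mul ℂ (Op H) X) ∘L ((ContinuousLinearMap.mul ℂ (Op H)).flip Y)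

theorem sandwich_apply (X Y A : Op H) : sandwich X Y A = X * (A * Y) := rfl

theorem sandwich_normal [CompleteSpace H] (X Y : Op H) (x y : H) :
    (vectorFunctional x y) ∘L (sandwich X Y) ∈ normalFunctionals H := by
  have : (vectorFunctional x y) ∘L (sandwich X Y) =
      vectorFunctional (ContinuousLinearMap.adjoint X x) (Y y) := by
    ext A
    simp [vectorFunctional, sandwich, ContinuousLinearMap.adjoint_inner_left]
  rw [this]
  exact vectorFunctional_mem _ _

end Normal

/-! ### The Hilbert space of square integrable functions and its operators -/

/-- Lebesgue measure on `(0, ∞)`. -/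
abbrev halfLine : Measure ℝ := volume.restrict (Set.Ioi (0 : ℝ))

/-- The positive real numbers, the index set of all one-parameter families below. -/
abbrev PosReal : Type := Set.Ioi (0 : ℝ)

section Space

variable (K : Type*) [NormedAddCommGroup K] [InnerProductSpace ℂ K]

/-- `K ⊗ L²(0, ∞)`, realized as the space of square integrable `K`-valued functions. -/
abbrev HSp : Type _ := Lp K 2 halfLine

variable {K}

theorem shift_measurePreserving (t : PosReal) :
    MeasurePreserving (fun x : ℝ => x - t.1) (halfLine.restrict (Set.Ioi t.1)) halfLine := by
  have h := (measurePreserving_sub_right (volume : Measure ℝ) t.1).restrict_preimage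
    (measurableSet_Ioi (a := (0 : ℝ)))
  have h2 : (fun x : ℝ => x - t.1) ⁻¹' (Set.Ioi 0) = Set.Ioi t.1 := by
    ext x; simp
  rw [h2] at h
  rwa [Measure.restrict_restrict_of_subset (Set.Ioi_subset_Ioi (le_of_lt t.2))]

/-- The right shift of a function, `x ↦ f (x - t)` for `x > t` and `0` for `x ≤ t`. -/
def shiftFun (t : PosReal) (f : ℝ → K) : ℝ → K :=
  (Set.Ioi t.1).indicator fun x => f (x - t.1)

theorem shiftFun_memLp (t : PosReal) {f : ℝ → K} (hf : MemLp f 2 halfLine) :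
    MemLp (shiftFun t f) 2 halfLine :=
  (memLp_indicator_iff_restrict measurableSet_Ioi).2
    (hf.comp_measurePreserving (shift_measurePreserving t))

theorem shiftFun_congr (t : PosReal) {f g : ℝ → K} (h : f =ᵐ[halfLine] g) :
    shiftFun t f =ᵐ[halfLine] shiftFun t g := by
  have h1 := (shift_measurePreserving t).quasiMeasurePreserving.ae_eq_comp h
  rw [Filter.EventuallyEq, ae_restrict_iff' measurableSet_Ioi] at h1
  filter_upwards [h1] with x hx
  by_cases hxt : x ∈ Set.Ioi t.1
  · simpa [shiftFun, hxt] using hx hxt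
  · simp [shiftFun, hxt]

/-- The right shift `S_t` on `K ⊗ L²(0, ∞)`. -/
def shift (t : PosReal) : Op (HSp K) :=
  LinearMap.mkContinuous
    { toFun := fun f => (shiftFun_memLp t (Lp.memLp f)).toLp (shiftFun t f)
      map_add' := fun f g => by
        rw [← MemLp.toLp_add, MemLp.toLp_eq_toLp_iff]
        refine (shiftFun_congr t (Lp.coeFn_add f g)).trans (Filter.EventuallyEq.of_eq ?_)
        exact Set.indicator_add _ _ _
      map_smul' := fun c f => by
        rw [RingHom.id_apply, ← MemLp.toLp_const_smul, MemLp.toLp_eq_toLp_iff]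
        refine (shiftFun_congr t (Lp.coeFn_smul c f)).trans (Filter.EventuallyEq.of_eq ?_)
        exact Set.indicator_const_smul _ _ _ } 1
    (fun f => by
      rw [one_mul]
      change ‖(shiftFun_memLp t (Lp.memLp f)).toLp (shiftFun t f)‖ ≤ ‖f‖
      rw [Lp.norm_toLp, Lp.norm_def, shiftFun,
        eLpNorm_indicator_eq_eLpNorm_restrict measurableSet_Ioi]
      have := eLpNorm_comp_measurePreserving (p := 2) (Lp.aestronglyMeasurable f)
        (shift_measurePreserving t)
      exact (congrArg ENNReal.toReal this).le)

theorem coeFn_shift (t : PosReal) (f : HSp K) :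
    (shift t f : ℝ → K) =ᵐ[halfLine] shiftFun t f :=
  MemLp.coeFn_toLp (shiftFun_memLp t (Lp.memLp f))

/-- Multiplication by an essentially bounded function. -/
def mulOp (φ : Lp ℂ ∞ halfLine) : Op (HSp K) :=
  (ContinuousLinearMap.lsmul ℂ ℂ).holderL halfLine ∞ 2 2 φ

theorem coeFn_mulOp (φ : Lp ℂ ∞ halfLine) (f : HSp K) :
    (mulOp φ f : ℝ → K) =ᵐ[halfLine] fun x => φ x • f x :=
  ContinuousLinearMap.coeFn_holder _ φ f

theorem expFun_memLp : MemLp (fun x : ℝ => ((Real.exp (-x) : ℝ) : ℂ)) ∞ halfLine := by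
  refine memLp_top_of_bound (Continuous.aestronglyMeasurable (by fun_prop)) 1 ?_
  filter_upwards [ae_restrict_mem measurableSet_Ioi] with x hx
  have hx : (0 : ℝ) < x := hx
  rw [Complex.norm_real, Real.norm_of_nonneg (Real.exp_pos _).le]
  exact Real.exp_le_one_iff.2 (by linarith)

theorem norm_mulOp_exp_le : ‖(mulOp expFun_memLp.toLp : Op (HSp K))‖ ≤ 1 := by
  refine ContinuousLinearMap.opNorm_le_bound _ zero_le_one fun f => ?_
  refine Lp.norm_le_mul_norm_of_ae_le_mul ?_
  filter_upwards [coeFn_mulOp (expFun_memLp.toLp) f, expFun_memLp.coeFn_toLp,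
    ae_restrict_mem measurableSet_Ioi] with x h1 h2 hx
  have hx : (0 : ℝ) < x := hx
  rw [h1, h2, norm_smul, Complex.norm_real, Real.norm_of_nonneg (Real.exp_pos _).le]
  exact mul_le_mul_of_nonneg_right (Real.exp_le_one_iff.2 (by linarith)) (norm_nonneg _)

/-- The map `Λ : B(K) → B(K ⊗ L²(0, ∞))`, `(Λ(A) f)(x) = e⁻ˣ A f(x)`. -/
def Lam : Op K →L[ℂ] Op (HSp K) :=
  LinearMap.mkContinuous
    { toFun := fun A => mulOp expFun_memLp.toLp ∘L A.compLpL 2 halfLine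
      map_add' := fun A B => by rw [ContinuousLinearMap.add_compLpL, ContinuousLinearMap.comp_add]
      map_smul' := fun c A => by
        rw [ContinuousLinearMap.smul_compLpL, ContinuousLinearMap.comp_smul, RingHom.id_apply] } 1
    (fun A => by
      change ‖mulOp expFun_memLp.toLp ∘L A.compLpL 2 halfLine‖ ≤ 1 * ‖A‖
      refine (ContinuousLinearMap.opNorm_comp_le _ _).trans ?_
      exact mul_le_mul norm_mulOp_exp_le (ContinuousLinearMap.norm_compLpL_le A)
        (norm_nonneg _) zero_le_one)

theorem norm_Lam_le (A : Op K) : ‖(Lam A : Op (HSp K))‖ ≤ ‖A‖ := by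
  simpa using (Lam (K := K)).le_of_opNorm_le (LinearMap.mkContinuous_norm_le _ zero_le_one _) A

theorem coeFn_Lam (A : Op K) (f : HSp K) :
    (Lam A f : ℝ → K) =ᵐ[halfLine] fun x => ((Real.exp (-x) : ℝ) : ℂ) • A (f x) := by
  have h : Lam A f = mulOp expFun_memLp.toLp (A.compLpL 2 halfLine f) := rfl
  rw [h]
  filter_upwards [coeFn_mulOp (expFun_memLp.toLp) (A.compLpL 2 halfLine f),
    expFun_memLp.coeFn_toLp, ContinuousLinearMap.coeFn_compLpL A f] with x h1 h2 h3
  rw [h1, h2, h3]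

end Space

section Boundary

variable (K : Type*) [NormedAddCommGroup K] [InnerProductSpace ℂ K] [CompleteSpace K]

variable {K}

theorem vectorFunctional_add_left (x x' y : K) :
    vectorFunctional (x + x') y = vectorFunctional x y + vectorFunctional x' y := by
  ext A; simp [vectorFunctional]

theorem vectorFunctional_add_right (x y y' : K) :
    vectorFunctional x (y + y') = vectorFunctional x y + vectorFunctional x y' := by
  ext A; simp [vectorFunctional]

theorem Lam_normal (f g : HSp K) : (vectorFunctional f g) ∘L Lam ∈ normalFunctionals K := by
  have hcl : IsClosed (normalFunctionals K : Set (Op K →L[ℂ] ℂ)) :=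
    Submodule.isClosed_topologicalClosure _
  refine Lp.induction (by norm_num)
    (motive := fun f : HSp K => (vectorFunctional f g) ∘L Lam ∈ normalFunctionals K) ?_ ?_ ?_ f
  · intro c s hs hμs
    refine Lp.induction (by norm_num) (motive := fun g : HSp K =>
      (vectorFunctional ((Lp.simpleFunc.indicatorConst 2 hs hμs.ne c : Lp.simpleFunc K 2 halfLine)
        : HSp K) g) ∘L Lam ∈ normalFunctionals K) ?_ ?_ ?_ g
    · intro d s' hs' hμs'
      rw [Lp.simpleFunc.coe_indicatorConst, Lp.simpleFunc.coe_indicatorConst]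
      have : (vectorFunctional (indicatorConstLp 2 hs hμs.ne c)
          (indicatorConstLp 2 hs' hμs'.ne d)) ∘L Lam =
          (∫ x in s, s'.indicator (fun x : ℝ => ((Real.exp (-x) : ℝ) : ℂ)) x ∂halfLine) •
            vectorFunctional c d := by
        ext A
        have h1 : ((vectorFunctional (indicatorConstLp 2 hs hμs.ne c)
          (indicatorConstLp 2 hs' hμs'.ne d)) ∘L Lam) A =
          inner ℂ (indicatorConstLp 2 hs hμs.ne c : HSp K)
            (Lam A (indicatorConstLp 2 hs' hμs'.ne d)) := rfl
        have h2 : ∀ a : ℂ, (a • vectorFunctional c d) A = a * inner ℂ c (A d) := fun a => rfl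
        rw [h1, h2, L2.inner_indicatorConstLp_eq_setIntegral_inner, ← integral_mul_const]
        refine integral_congr_ae (ae_restrict_of_ae ?_)
        filter_upwards [coeFn_Lam A (indicatorConstLp 2 hs' hμs'.ne d : HSp K),
          indicatorConstLp_coeFn (p := 2) (hs := hs') (hμs := hμs'.ne) (c := d)] with x hx hx'
        rw [hx, hx']
        by_cases hxs : x ∈ s'
        · simp [hxs, inner_smul_right]
        · simp [hxs]
      rw [this]
      exact Submodule.smul_mem _ _ (vectorFunctional_mem _ _)
    · intro u v hu hv _ h1 h2
      rw [vectorFunctional_add_right, ContinuousLinearMap.add_comp]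
      exact Submodule.add_mem _ h1 h2
    · refine hcl.preimage (f := fun g : HSp K => (vectorFunctional _ g) ∘L Lam) ?_
      unfold vectorFunctional
      fun_prop
  · intro u v hu hv _ h1 h2
    rw [vectorFunctional_add_left, ContinuousLinearMap.add_comp]
    exact Submodule.add_mem _ h1 h2
  · refine hcl.preimage (f := fun f : HSp K => (vectorFunctional f g) ∘L Lam) ?_
    unfold vectorFunctional
    fun_prop

/-- The predual map `Λ̂` of `Λ`. -/
def LamHat : Predual (HSp K) →ₗ[ℂ] Predual K := preadjoint Lam Lam_normal

variable (K) in
/-- The operator `(I - Λ(I))^{1/2}`. -/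
def Dop : Op (HSp K) := posSqrt (1 - Lam 1)

/-- The projection `E(t, ∞) = S_t S_t^*`. -/
def proj (t : PosReal) : Op (HSp K) := shift t * star (shift t)

theorem sqrtFun_memLp :
    MemLp (fun x : ℝ => ((Real.sqrt (1 - Real.exp (-x)) : ℝ) : ℂ)) ∞ halfLine := by
  refine memLp_top_of_bound (Continuous.aestronglyMeasurable (by fun_prop)) 1 ?_
  filter_upwards with x
  rw [Complex.norm_real, Real.norm_of_nonneg (Real.sqrt_nonneg _)]
  exact Real.sqrt_le_one.2 (by linarith [Real.exp_pos (-x)])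

theorem sqrtOp_mul_self :
    (mulOp sqrtFun_memLp.toLp * mulOp sqrtFun_memLp.toLp : Op (HSp K)) = 1 - Lam 1 := by
  ext1 f
  apply Lp.ext
  have h1 : (1 - Lam 1 : Op (HSp K)) f = f - Lam 1 f := rfl
  have h2 : (mulOp sqrtFun_memLp.toLp * mulOp sqrtFun_memLp.toLp : Op (HSp K)) f =
    mulOp sqrtFun_memLp.toLp (mulOp sqrtFun_memLp.toLp f) := rfl
  rw [h1, h2]
  filter_upwards [coeFn_mulOp sqrtFun_memLp.toLp (mulOp sqrtFun_memLp.toLp f),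
    coeFn_mulOp sqrtFun_memLp.toLp f, sqrtFun_memLp.coeFn_toLp, coeFn_Lam 1 f,
    Lp.coeFn_sub f (Lam 1 f), ae_restrict_mem measurableSet_Ioi] with x a1 a2 a3 a4 a5 hx
  have hx : (0 : ℝ) < x := hx
  have hs : 0 ≤ 1 - Real.exp (-x) := by
    linarith [Real.exp_le_one_iff.2 (show -x ≤ 0 by linarith)]
  rw [a1, a2, a5, Pi.sub_apply, a4, a3, smul_smul, ← Complex.ofReal_mul,
    Real.mul_self_sqrt hs]
  simp [sub_smul]

theorem Dop_eq : Dop K = mulOp sqrtFun_memLp.toLp := by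
  refine posSqrt_eq sqrtOp_mul_self ?_
  rw [ContinuousLinearMap.nonneg_iff_isPositive, ContinuousLinearMap.isPositive_iff_complex]
  intro f
  have : inner ℂ (mulOp sqrtFun_memLp.toLp f) f =
      ((∫ x, Real.sqrt (1 - Real.exp (-x)) * ‖f x‖ ^ 2 ∂halfLine : ℝ) : ℂ) := by
    rw [L2.inner_def, ← integral_complex_ofReal]
    refine integral_congr_ae ?_
    filter_upwards [coeFn_mulOp sqrtFun_memLp.toLp f, sqrtFun_memLp.coeFn_toLp] with x a1 a2
    rw [a1, a2, inner_smul_left, inner_self_eq_norm_sq_to_K, Complex.conj_ofReal]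
    push_cast
    rfl
  rw [this]
  refine ⟨by simp, ?_⟩
  simp only [RCLike.re_to_complex, Complex.ofReal_re]
  exact integral_nonneg fun x => mul_nonneg (Real.sqrt_nonneg _) (sq_nonneg _)

theorem star_Dop : star (Dop K) = Dop K := star_posSqrt _

theorem Dop_mul_Dop : Dop K * Dop K = 1 - Lam 1 := by
  rw [Dop_eq, sqrtOp_mul_self]

/-- The function `(1 - e⁻ˣ)^{-1/2}` cut off to `x > t`. -/
def invFun (t : PosReal) : ℝ → ℂ :=
  (Set.Ioi t.1).indicator fun x => (((Real.sqrt (1 - Real.exp (-x)))⁻¹ : ℝ) : ℂ)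

theorem invFun_memLp (t : PosReal) : MemLp (invFun t) ∞ halfLine := by
  refine memLp_top_of_bound (Measurable.aestronglyMeasurable
    (Measurable.indicator (by fun_prop) measurableSet_Ioi))
    ((Real.sqrt (1 - Real.exp (-t.1)))⁻¹) ?_
  have ht : 0 < t.1 := t.2
  have h0 : 0 < 1 - Real.exp (-t.1) := by
    linarith [Real.exp_lt_one_iff.2 (show -t.1 < 0 by linarith)]
  filter_upwards with x
  by_cases hx : x ∈ Set.Ioi t.1
  · have hx' : t.1 < x := hx
    rw [invFun, Set.indicator_of_mem hx, Complex.norm_real, Real.norm_of_nonneg (by positivity)]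
    refine inv_anti₀ (Real.sqrt_pos.2 h0) (Real.sqrt_le_sqrt ?_)
    linarith [Real.exp_le_exp.2 (show -x ≤ -t.1 by linarith)]
  · rw [invFun, Set.indicator_of_notMem hx, norm_zero]
    positivity

theorem Dop_mul_shift (t : PosReal) :
    Dop K * (mulOp (invFun_memLp t).toLp * shift t) = shift t := by
  rw [Dop_eq]
  ext1 f
  apply Lp.ext
  have h2 : (mulOp sqrtFun_memLp.toLp * (mulOp (invFun_memLp t).toLp * shift t) : Op (HSp K)) f =
    mulOp sqrtFun_memLp.toLp (mulOp (invFun_memLp t).toLp (shift t f)) := rfl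
  rw [h2]
  filter_upwards [coeFn_mulOp sqrtFun_memLp.toLp (mulOp (invFun_memLp t).toLp (shift t f)),
    coeFn_mulOp (invFun_memLp t).toLp (shift t f), sqrtFun_memLp.coeFn_toLp,
    (invFun_memLp t).coeFn_toLp, coeFn_shift t f] with x a1 a2 a3 a4 a5
  rw [a1, a2, a3, a4, a5, smul_smul]
  by_cases hx : x ∈ Set.Ioi t.1
  · have hx' : t.1 < x := hx
    have ht : 0 < t.1 := t.2
    have h0 : 0 < 1 - Real.exp (-x) := by
      linarith [Real.exp_lt_one_iff.2 (show -x < 0 by linarith)]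
    rw [invFun, Set.indicator_of_mem hx, ← Complex.ofReal_mul,
      mul_inv_cancel₀ (Real.sqrt_pos.2 h0).ne', Complex.ofReal_one, one_smul]
  · simp [shiftFun, hx]

/-- An operator `W` with `E(t, ∞) = (I - Λ(I))^{1/2} W`. -/
def cutW (t : PosReal) : Op (HSp K) :=
  mulOp (invFun_memLp t).toLp * shift t * star (shift t)

theorem Dop_mul_cutW (t : PosReal) : Dop K * cutW t = proj t := by
  rw [cutW, ← mul_assoc, Dop_mul_shift, proj]

theorem cutW_mul_Dop (t : PosReal) : star (cutW t) * Dop K = proj t := by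
  have := congrArg star (Dop_mul_cutW (K := K) t)
  rwa [star_mul, star_Dop, proj, star_mul, star_star] at this

end Boundary

/-! ### Boundary weights -/

section Weights

variable (K : Type*) [NormedAddCommGroup K] [InnerProductSpace ℂ K] [CompleteSpace K]

/-- `𝔄(H) = (I - Λ(I))^{1/2} B(H) (I - Λ(I))^{1/2}`, for `H = K ⊗ L²(0, ∞)`. -/
def boundaryAlgebra : Subspc (Op (HSp K)) :=
  LinearMap.range (sandwich (Dop K) (Dop K) : Op (HSp K) →ₗ[ℂ] Op (HSp K))

/-- The map `A ↦ (I - Λ(I))^{1/2} A (I - Λ(I))^{1/2}` from `B(H)` onto `𝔄(H)`. -/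
def compress : Op (HSp K) →ₗ[ℂ] boundaryAlgebra K :=
  LinearMap.rangeRestrict (sandwich (Dop K) (Dop K) : Op (HSp K) →ₗ[ℂ] Op (HSp K))

/-- `𝔄(H)_*`: the linear functionals `μ` on `𝔄(H)` for which
`A ↦ μ((I - Λ(I))^{1/2} A (I - Λ(I))^{1/2})` is a normal bounded functional on `B(H)`. -/
def BoundaryWeight : Submodule ℂ (boundaryAlgebra K →ₗ[ℂ] ℂ) where
  carrier := {μ | ∃ ℓ ∈ normalFunctionals (HSp K), ∀ A, μ (compress K A) = ℓ A}
  add_mem' := by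
    rintro μ ν ⟨ℓ, hℓ, h⟩ ⟨m, hm, h'⟩
    exact ⟨ℓ + m, Submodule.add_mem _ hℓ hm, fun A => by simp [h, h']⟩
  zero_mem' := ⟨0, Submodule.zero_mem _, fun A => by simp⟩
  smul_mem' := by
    rintro c μ ⟨ℓ, hℓ, h⟩
    exact ⟨c • ℓ, Submodule.smul_mem _ c hℓ, fun A => by simp [h]⟩

/-- Boundary weight maps over `K`. -/
abbrev BoundaryWeightMap : Type _ := Predual K →ₗ[ℂ] BoundaryWeight K

variable {K}

theorem cut_eq (t : PosReal) (A : Op (HSp K)) :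
    (sandwich (proj t) (proj t)) A =
      (compress K (sandwich (cutW t) (star (cutW t)) A) : Op (HSp K)) := by
  have h : (compress K (sandwich (cutW t) (star (cutW t)) A) : Op (HSp K)) =
    Dop K * ((cutW t * (A * star (cutW t))) * Dop K) := rfl
  rw [h, sandwich_apply]
  nth_rewrite 1 [← Dop_mul_cutW]
  rw [← cutW_mul_Dop]
  simp only [mul_assoc]

/-- The map `A ↦ E(t, ∞) A E(t, ∞)` from `B(H)` to `𝔄(H)`. -/
def cut (t : PosReal) : Op (HSp K) →ₗ[ℂ] boundaryAlgebra K :=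
  LinearMap.codRestrict (boundaryAlgebra K)
    (sandwich (proj (K := K) t) (proj t) : Op (HSp K) →ₗ[ℂ] Op (HSp K))
    (fun A => by
      have h := (compress K (sandwich (cutW t) (star (cutW t)) A)).2
      rw [← cut_eq] at h
      exact h)

theorem truncate_aux (t : PosReal) (μ : BoundaryWeight K) :
    ∃ ℓ ∈ normalFunctionals (HSp K), ∀ A, μ.1 (cut t A) = ℓ A := by
  obtain ⟨ℓ, hℓ, h⟩ := μ.2
  refine ⟨ℓ ∘L sandwich (cutW t) (star (cutW t)),
    comp_mem_predual _ (sandwich_normal _ _) ℓ hℓ, fun A => ?_⟩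
  have : cut t A = compress K (sandwich (cutW t) (star (cutW t)) A) :=
    Subtype.ext (cut_eq t A)
  rw [this, h]
  rfl

/-- The truncation of a boundary weight, `A ↦ μ(E(t, ∞) A E(t, ∞))`. -/
def truncate (t : PosReal) : BoundaryWeight K →ₗ[ℂ] Predual (HSp K) where
  toFun μ := Predual.mk
    { toLinearMap := μ.1 ∘ₗ cut t
      cont := by
        obtain ⟨ℓ, -, h⟩ := truncate_aux t μ
        exact ℓ.continuous.congr fun A => (h A).symm }
      (by
        obtain ⟨ℓ, hℓ, h⟩ := truncate_aux t μ
        convert hℓ using 1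
        ext1 A
        exact h A)
  map_add' _ _ := rfl
  map_smul' _ _ := rfl

/-- The element `I - Λ(I)` of `𝔄(H)`. -/
def oneSubLam : boundaryAlgebra K :=
  ⟨1 - Lam 1, 1, by
    change Dop K * (1 * Dop K) = _
    rw [one_mul, Dop_mul_Dop]⟩

/-- The truncated boundary weight map `ω|_t`. -/
def trunc (ω : BoundaryWeightMap K) (t : PosReal) : Predual K →ₗ[ℂ] Predual (HSp K) :=
  truncate t ∘ₗ ω

/-- The map `I + Λ̂ ω|_t` on `B(K)_*`. -/
def resolventMap (ω : BoundaryWeightMap K) (t : PosReal) : Module.End ℂ (Predual K) :=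
  1 + LamHat ∘ₗ trunc ω t

/-- The map `π̂_t = ω|_t (I + Λ̂ ω|_t)⁻¹`, meaningful when `I + Λ̂ ω|_t` is invertible. -/
def piHat (ω : BoundaryWeightMap K) (t : PosReal) : Predual K →ₗ[ℂ] Predual (HSp K) :=
  trunc ω t ∘ₗ Ring.inverse (resolventMap ω t)

end Weights

/-! ### Complete positivity, duality, and `q`-weight maps -/

section Positivity

variable {H K : Type*} [NormedAddCommGroup H] [InnerProductSpace ℂ H] [CompleteSpace H]
  [NormedAddCommGroup K] [InnerProductSpace ℂ K] [CompleteSpace K]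

/-- Positive normal functionals. -/
def IsPosFunctional (ρ : Predual K) : Prop := ∀ A : Op K, 0 ≤ A → 0 ≤ ρ A

/-- The positive cone of `M_n(B(K)_*)`: the matrices `(ρ_ij)` for which `∑ ρ_ij(A_ij) ≥ 0` for
every positive `(A_ij)` in `M_n(B(K))`. -/
def IsPosMatrix {n : ℕ} (ρ : Fin n → Fin n → Predual K) : Prop :=
  ∀ A : CStarMatrix (Fin n) (Fin n) (Op K), 0 ≤ A → 0 ≤ ∑ i, ∑ j, (ρ i j) (A i j)

/-- The positive cone of `M_n(𝔄(H)_*)`: the matrices `(μ_ij)` for which `∑ μ_ij(T_ij) ≥ 0` for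
every matrix `(T_ij)` over `𝔄(H)` that is positive in `M_n(B(H))`. -/
def IsPosWeightMatrix {n : ℕ} (μ : Fin n → Fin n → BoundaryWeight K) : Prop :=
  ∀ T : Fin n → Fin n → boundaryAlgebra K,
    0 ≤ (CStarMatrix.ofMatrix (Matrix.of fun i j => (T i j : Op (HSp K)))) →
      0 ≤ ∑ i, ∑ j, (μ i j).1 (T i j)

/-- Complete positivity of a linear map between preduals. -/
def IsCPPredual (φ : Predual K →ₗ[ℂ] Predual H) : Prop :=
  ∀ (n : ℕ) (ρ : Fin n → Fin n → Predual K), IsPosMatrix ρ → IsPosMatrix fun i j => φ (ρ i j)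

/-- Complete positivity of a boundary weight map. -/
def IsCPWeightMap (ω : BoundaryWeightMap K) : Prop :=
  ∀ (n : ℕ) (ρ : Fin n → Fin n → Predual K), IsPosMatrix ρ →
    IsPosWeightMatrix fun i j => ω (ρ i j)

/-- Complete positivity of a linear map `B(H) → B(K)`. -/
def IsCP (φ : Op H →ₗ[ℂ] Op K) : Prop :=
  ∃ Φ : CompletelyPositiveMap (Op H) (Op K), Φ.toLinearMap = φ

/-- A boundary weight map `ω` is a `q`-weight map if it is completely positive,
`ω(ρ)(I - Λ(I)) ≤ ρ(I)` for positive `ρ`, and for all `t > 0` the map `I + Λ̂ ω|_t` is invertible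
and `π̂_t` is a completely positive contraction. -/
structure IsQWeightMap (ω : BoundaryWeightMap K) : Prop where
  cp : IsCPWeightMap ω
  le_one : ∀ ρ : Predual K, IsPosFunctional ρ → (ω ρ).1 oneSubLam ≤ ρ 1
  invertible : ∀ t : PosReal, IsUnit (resolventMap ω t)
  cp_piHat : ∀ t : PosReal, IsCPPredual (piHat ω t)
  contraction_piHat : ∀ (t : PosReal) (ρ : Predual K), ‖piHat ω t ρ‖ ≤ ‖ρ‖

theorem norm_vectorFunctional_le (x y : K) : ‖vectorFunctional x y‖ ≤ ‖x‖ * ‖y‖ := by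
  refine ContinuousLinearMap.opNorm_le_bound _ (by positivity) fun A => ?_
  calc ‖inner ℂ x (A y)‖ ≤ ‖x‖ * ‖A y‖ := norm_inner_le_norm _ _
    _ ≤ ‖x‖ * (‖A‖ * ‖y‖) := by gcongr; exact A.le_opNorm y
    _ = ‖x‖ * ‖y‖ * ‖A‖ := by ring

/-- The vector functionals as elements of the predual. -/
def vecPredual (x y : K) : Predual K :=
  Predual.mk (vectorFunctional x y) (vectorFunctional_mem x y)

theorem op_ext {A B : Op K} (h : ∀ ρ : Predual K, ρ A = ρ B) : A = B := by
  ext1 y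
  exact ext_inner_left ℂ fun x => h (vecPredual x y)

theorem exists_op (c : Predual K →ₗ[ℂ] ℂ) (C : ℝ) (hC : ∀ ρ, ‖c ρ‖ ≤ C * ‖ρ‖) :
    ∃ B : Op K, ∀ ρ : Predual K, ρ B = c ρ := by
  let b : K →ₗ⋆[ℂ] K →ₗ[ℂ] ℂ := LinearMap.mk₂'ₛₗ (starRingEnd ℂ) (RingHom.id ℂ)
    (fun x y => c (vecPredual x y))
    (fun x x' y => by
      rw [← map_add]; exact congrArg c (Predual.ext fun A => by
        exact congrArg (fun f => f A) (vectorFunctional_add_left x x' y)))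
    (fun a x y => by
      rw [smul_eq_mul, ← smul_eq_mul, ← map_smul]
      refine congrArg c (Predual.ext fun A => ?_)
      exact inner_smul_left (𝕜 := ℂ) x (A y) a)
    (fun x y y' => by
      rw [← map_add]; exact congrArg c (Predual.ext fun A => by
        exact congrArg (fun f => f A) (vectorFunctional_add_right x y y')))
    (fun a x y => by
      rw [RingHom.id_apply, ← map_smul]
      refine congrArg c (Predual.ext fun A => ?_)
      change inner ℂ x (A (a • y)) = a * inner ℂ x (A y)
      rw [map_smul, inner_smul_right])
  let b' : K →L⋆[ℂ] K →L[ℂ] ℂ := LinearMap.mkContinuous₂ b |C| (fun x y => by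
    rw [mul_assoc]
    exact (hC _).trans ((mul_le_mul_of_nonneg_right (le_abs_self C) (norm_nonneg _)).trans
      (mul_le_mul_of_nonneg_left (norm_vectorFunctional_le x y) (abs_nonneg C))))
  let B : Op K := ContinuousLinearMap.adjoint (InnerProductSpace.continuousLinearMapOfBilin b')
  have hB : ∀ x y, inner ℂ x (B y) = c (vecPredual x y) := fun x y => by
    rw [ContinuousLinearMap.adjoint_inner_right]
    exact InnerProductSpace.continuousLinearMapOfBilin_apply b' x y
  refine ⟨B, fun ρ => ?_⟩
  have hspan : ∀ σ ∈ Submodule.span ℂ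
      (Set.range fun p : K × K => vectorFunctional p.1 p.2), ∀ hσ : σ ∈ normalFunctionals K,
      c (Predual.mk σ hσ) = σ B := by
    intro σ hσ
    induction hσ using Submodule.span_induction with
    | mem σ h =>
      obtain ⟨p, rfl⟩ := h
      exact fun _ => (hB p.1 p.2).symm
    | zero => exact fun h => map_zero c
    | add σ τ h1 h2 i1 i2 =>
      intro h
      have m1 : σ ∈ normalFunctionals K := Submodule.le_topologicalClosure _ h1
      have m2 : τ ∈ normalFunctionals K := Submodule.le_topologicalClosure _ h2
      have e : Predual.mk (σ + τ) h = Predual.mk σ m1 + Predual.mk τ m2 := rfl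
      rw [e, map_add, i1, i2]
      rfl
    | smul a σ h1 i1 =>
      intro h
      have m1 : σ ∈ normalFunctionals K := Submodule.le_topologicalClosure _ h1
      have e : Predual.mk (a • σ) h = a • Predual.mk σ m1 := rfl
      rw [e, map_smul, i1]
      rfl
  have hd : ∀ ε > 0, ‖ρ B - c ρ‖ ≤ (‖B‖ + |C|) * ε := by
    intro ε hε
    obtain ⟨σ, hσ, hρσ⟩ := Metric.mem_closure_iff.1
      (show Predual.toDual ρ ∈ closure _ from ρ.toDual_mem) ε hε
    have hσ' : σ ∈ normalFunctionals K := Submodule.le_topologicalClosure _ hσ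
    rw [dist_eq_norm] at hρσ
    have hρσ' : ‖ρ - Predual.mk σ hσ'‖ < ε := hρσ
    have h1 : ρ B - c ρ = (Predual.toDual ρ - σ) B - c (ρ - Predual.mk σ hσ') := by
      rw [map_sub, hspan σ hσ hσ', sub_apply]
      ring
    have h2 : ‖(Predual.toDual ρ - σ) B‖ ≤ ε * ‖B‖ :=
      ((Predual.toDual ρ - σ).le_opNorm B).trans (by gcongr)
    have h3 : ‖c (ρ - Predual.mk σ hσ')‖ ≤ |C| * ε :=
      (hC _).trans ((mul_le_mul_of_nonneg_right (le_abs_self C) (norm_nonneg _)).trans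
        (mul_le_mul_of_nonneg_left hρσ'.le (abs_nonneg C)))
    rw [h1]
    refine (norm_sub_le _ _).trans ?_
    linarith
  refine sub_eq_zero.1 (norm_le_zero_iff.1 (le_of_forall_pos_le_add fun ε hε => ?_))
  have hp : 0 < ‖B‖ + |C| + 1 := by positivity
  have := hd (ε / (‖B‖ + |C| + 1)) (by positivity)
  refine this.trans ?_
  rw [zero_add, mul_div_assoc', div_le_iff₀ hp]
  nlinarith

/-- The dual map of a linear map `φ` from `B(K)_*` to functionals on `V`: the unique linear map
`ψ : V → B(K)` with `ρ(ψ(v)) = φ(ρ)(v)`. It exists as soon as every functional `ρ ↦ φ(ρ)(v)` is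
bounded (`dualMap_spec`), in particular for the maps attached to a `q`-weight map below. -/
def dualMap {V : Type*} [AddCommGroup V] [Module ℂ V] (φ : Predual K →ₗ[ℂ] (V →ₗ[ℂ] ℂ)) :
    V →ₗ[ℂ] Op K :=
  open Classical in
  if h : ∃ ψ : V →ₗ[ℂ] Op K, ∀ (ρ : Predual K) (v : V), ρ (ψ v) = φ ρ v then h.choose else 0

theorem dualMap_spec {V : Type*} [AddCommGroup V] [Module ℂ V]
    (φ : Predual K →ₗ[ℂ] (V →ₗ[ℂ] ℂ))
    (hφ : ∀ v, ∃ C : ℝ, ∀ ρ, ‖φ ρ v‖ ≤ C * ‖ρ‖) (ρ : Predual K) (v : V) :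
    ρ (dualMap φ v) = φ ρ v := by
  have h : ∃ ψ : V →ₗ[ℂ] Op K, ∀ (ρ : Predual K) (v : V), ρ (ψ v) = φ ρ v := by
    have hB : ∀ v, ∃ B : Op K, ∀ ρ : Predual K, ρ B = φ ρ v := fun v => by
      obtain ⟨C, hC⟩ := hφ v
      exact exists_op ((LinearMap.applyₗ v) ∘ₗ φ) C hC
    choose B hB using hB
    refine ⟨{ toFun := B, map_add' := fun v w => ?_, map_smul' := fun a v => ?_ },
      fun ρ v => hB v ρ⟩
    · exact op_ext fun ρ => by rw [map_add, hB, hB, hB, map_add]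
    · exact op_ext fun ρ => by rw [RingHom.id_apply, map_smul, hB, hB, map_smul]
  rw [dualMap, dif_pos h]
  exact h.choose_spec ρ v

/-- The dualized boundary weight map `ω̆ : 𝔄(H) → B(K)`, with `ρ(ω̆(T)) = ω(ρ)(T)`. -/
def dualized (ω : BoundaryWeightMap K) : boundaryAlgebra K →ₗ[ℂ] Op K :=
  dualMap ((BoundaryWeight K).subtype ∘ₗ ω)

/-- `ω` has finite range rank: the range of `ω̆` is finite-dimensional. -/
def HasFiniteRangeRank (ω : BoundaryWeightMap K) : Prop :=
  FiniteDimensional ℂ (LinearMap.range (dualized ω))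

/-- The generalized boundary representation `π_t^# : B(H) → B(K)`, with
`ρ(π_t^#(A)) = π̂_t(ρ)(A)`. -/
def genRep (ω : BoundaryWeightMap K) (t : PosReal) : Op (HSp K) →ₗ[ℂ] Op K :=
  dualMap ((ContinuousLinearMap.coeLM ℂ ∘ₗ Predual.toDual) ∘ₗ piHat ω t)

theorem genRep_spec {ω : BoundaryWeightMap K} (hω : IsQWeightMap ω) (t : PosReal)
    (ρ : Predual K) (A : Op (HSp K)) : ρ (genRep ω t A) = (piHat ω t ρ) A := by
  refine dualMap_spec _ (fun A => ⟨‖A‖, fun ρ => ?_⟩) ρ A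
  change ‖(piHat ω t ρ) A‖ ≤ _
  refine ((Predual.toDual (piHat ω t ρ)).le_opNorm A).trans ?_
  rw [mul_comm]
  exact mul_le_mul_of_nonneg_left (hω.contraction_piHat t ρ) (norm_nonneg A)

theorem norm_genRep_le {ω : BoundaryWeightMap K} (hω : IsQWeightMap ω) (t : PosReal)
    (A : Op (HSp K)) : ‖genRep ω t A‖ ≤ ‖A‖ := by
  refine ContinuousLinearMap.opNorm_le_bound _ (norm_nonneg A) fun y => ?_
  set x := genRep ω t A y with hx
  have h1 : inner ℂ x x = (piHat ω t (vecPredual x y)) A :=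
    genRep_spec hω t (vecPredual x y) A
  have h2 : ‖x‖ * ‖x‖ ≤ ‖x‖ * (‖A‖ * ‖y‖) := by
    have h3 : ‖(piHat ω t (vecPredual x y)) A‖ ≤ (‖x‖ * ‖y‖) * ‖A‖ :=
      ((Predual.toDual (piHat ω t (vecPredual x y))).le_opNorm A).trans (mul_le_mul_of_nonneg_right
        ((hω.contraction_piHat t _).trans (norm_vectorFunctional_le x y)) (norm_nonneg A))
    rw [← h1, inner_self_eq_norm_sq_to_K] at h3
    simp only [norm_pow, RCLike.norm_ofReal, abs_norm] at h3
    linarith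
  by_cases h0 : ‖x‖ = 0
  · rw [h0]; positivity
  · exact le_of_mul_le_mul_left h2 (lt_of_le_of_ne (norm_nonneg x) (Ne.symm h0))

/-- Convergence `X_t → X` as `t → 0+` in the σ-strong topology of `B(K)`, given by the seminorms
`A ↦ ρ(A^* A)^{1/2}` for positive normal functionals `ρ`. -/
def SigmaStrongTendsto (X : PosReal → Op K) (X₀ : Op K) : Prop :=
  ∀ ρ : Predual K, IsPosFunctional ρ →
    Tendsto (fun t => ρ (star (X t - X₀) * (X t - X₀))) atBot (𝓝 0)

/-- `Φ : B(H) → B(K)` is the normal spine of `ω`: the σ-weakly continuous linear map such that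
`π_s^#(T)` converges σ-strongly to `Φ(T)` as `s → 0+` for all `T` in `⋃_{t > 0} S_t B(H) S_t^*`. -/
def IsNormalSpine (ω : BoundaryWeightMap K) (Φ : Op (HSp K) →ₗ[ℂ] Op K) : Prop :=
  (∀ ρ : Predual K, ∃ η : Predual (HSp K), ∀ A, η A = ρ (Φ A)) ∧
    ∀ (t : PosReal) (A : Op (HSp K)),
      SigmaStrongTendsto (fun s => genRep ω s (shift t * A * star (shift t)))
        (Φ (shift t * A * star (shift t)))

/-! ### The BW-topology and boundary expectations -/

variable (K) in
/-- The bounded linear maps `φ : B(K) → B(K)` with `‖φ‖ ≤ 1`. -/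
structure CMap where
  toMap : Op K →L[ℂ] Op K
  norm_le : ‖toMap‖ ≤ 1

/-- The relative BW-topology: `φ_i → φ` if and only if `ρ(φ_i(x)) → ρ(φ(x))` for all `x` in `B(K)`
and all `ρ` in `B(K)_*`. -/
instance : TopologicalSpace (CMap K) :=
  TopologicalSpace.induced
    (fun φ => fun p : Predual K × Op K => p.1 (φ.toMap p.2)) inferInstance

/-- The map `π_t^# ∘ Λ`. -/
def genRepLam {ω : BoundaryWeightMap K} (hω : IsQWeightMap ω) (t : PosReal) : Op K →L[ℂ] Op K :=
  LinearMap.mkContinuous (genRep ω t ∘ₗ (Lam : Op K →L[ℂ] Op (HSp K)).toLinearMap) 1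
    (fun A => by
      rw [one_mul]
      exact (norm_genRep_le hω t (Lam A)).trans (norm_Lam_le A))

/-- The net `t ↦ π_t^# ∘ Λ`. -/
def bwNet {ω : BoundaryWeightMap K} (hω : IsQWeightMap ω) (t : PosReal) : CMap K where
  toMap := genRepLam hω t
  norm_le := LinearMap.mkContinuous_norm_le _ zero_le_one _

/-- Boundary expectations for `ω`. -/
structure IsBoundaryExpectation (ω : BoundaryWeightMap K) (L : Op K →L[ℂ] Op K) : Prop where
  cp : IsCP (L : Op K →ₗ[ℂ] Op K)
  comp_dualized : (L : Op K →ₗ[ℂ] Op K) ∘ₗ dualized ω = dualized ω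
  range_eq : LinearMap.range (L : Op K →ₗ[ℂ] Op K) = LinearMap.range (dualized ω)
  idem : L ∘L L = L
  norm_eq : ‖L‖ = 1

end Positivity

end QWeight

end

noncomputable section

namespace QWeight
/-! ### Positivity of operator matrices -/

theorem exists_star_mul_self {A : Type*} [CStarAlgebra A] [PartialOrder A] [StarOrderedRing A]
    {a : A} (ha : 0 ≤ a) : ∃ s, a = star s * s :=
  CStarAlgebra.nonneg_iff_eq_star_mul_self.1 ha

theorem exists_neg_part {A : Type*} [CStarAlgebra A] [PartialOrder A] [StarOrderedRing A]
    {a : A} (ha : IsSelfAdjoint a) :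
    ∃ c s : A, c = star s * s ∧ a * c = -(c * c) ∧ (c * c = 0 → 0 ≤ a) := by
  have hc0 : 0 ≤ a⁻ := CFC.negPart_nonneg a
  obtain ⟨s, hs⟩ := exists_star_mul_self hc0
  refine ⟨a⁻, s, hs, ?_, fun h => ?_⟩
  · nth_rewrite 1 [← CFC.posPart_sub_negPart a ha]
    rw [sub_mul, CFC.posPart_mul_negPart, zero_sub]
  · refine (CFC.negPart_eq_zero_iff a ha).1 ((CStarRing.star_mul_self_eq_zero_iff _).1 ?_)
    rwa [(IsSelfAdjoint.of_nonneg hc0).star_eq]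

theorem complex_inner_self_nonneg {E : Type*} [NormedAddCommGroup E] [InnerProductSpace ℂ E]
    (x : E) : (0 : ℂ) ≤ inner ℂ x x := by
  rw [inner_self_eq_norm_sq_to_K]
  exact pow_nonneg (Complex.zero_le_real.2 (norm_nonneg x)) 2

section OperatorMatrix

variable {K : Type*} [NormedAddCommGroup K] [InnerProductSpace ℂ K] {n : ℕ}

/-- The operator on `Kⁿ` given by an `n × n` matrix of operators on `K`. -/
def matOp (M : CStarMatrix (Fin n) (Fin n) (Op K)) :
    PiLp 2 (fun _ : Fin n => K) →ₗ[ℂ] PiLp 2 (fun _ : Fin n => K) where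
  toFun x := WithLp.toLp 2 fun i => ∑ j, M i j (x j)
  map_add' x y := by
    ext i
    simp [Finset.sum_add_distrib]
  map_smul' c x := by
    ext i
    simp [Finset.smul_sum]

theorem matOp_apply (M : CStarMatrix (Fin n) (Fin n) (Op K)) (x : PiLp 2 (fun _ : Fin n => K))
    (i : Fin n) : matOp M x i = ∑ j, M i j (x j) := rfl

theorem inner_matOp (M : CStarMatrix (Fin n) (Fin n) (Op K))
    (x y : PiLp 2 (fun _ : Fin n => K)) :
    inner ℂ x (matOp M y) = ∑ i, ∑ j, inner ℂ (x i) (M i j (y j)) := by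
  simp [PiLp.inner_apply, matOp_apply, inner_sum]

theorem matOp_sub (M N : CStarMatrix (Fin n) (Fin n) (Op K)) :
    matOp (M - N) = matOp M - matOp N := by
  ext x i
  simp [matOp_apply]

theorem matOp_neg (M : CStarMatrix (Fin n) (Fin n) (Op K)) : matOp (-M) = -matOp M := by
  ext x i
  simp [matOp_apply]

theorem matOp_mul (M N : CStarMatrix (Fin n) (Fin n) (Op K)) (x : PiLp 2 (fun _ : Fin n => K)) :
    matOp (M * N) x = matOp M (matOp N x) := by
  ext i
  simp only [matOp_apply, CStarMatrix.mul_apply, _root_.sum_apply, map_sum]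
  exact Finset.sum_comm

theorem matOp_eq_zero {M : CStarMatrix (Fin n) (Fin n) (Op K)} (h : matOp M = 0) : M = 0 := by
  ext i j v
  have := congrArg (fun x : PiLp 2 (fun _ : Fin n => K) => x i)
    (LinearMap.congr_fun h (WithLp.toLp 2 (Pi.single j v)))
  simp only [matOp_apply, LinearMap.zero_apply, PiLp.zero_apply] at this
  rw [Finset.sum_eq_single j (fun k _ hk => by simp [hk]) (by simp)] at this
  simpa using this

variable [CompleteSpace K]

theorem inner_matOp_star (M : CStarMatrix (Fin n) (Fin n) (Op K))
    (x y : PiLp 2 (fun _ : Fin n => K)) :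
    inner ℂ x (matOp (star M) y) = inner ℂ (matOp M x) y := by
  rw [inner_matOp, ← inner_conj_symm, inner_matOp, Finset.sum_comm]
  simp only [map_sum, inner_conj_symm, CStarMatrix.star_apply]
  refine Finset.sum_congr rfl fun i _ => Finset.sum_congr rfl fun j _ => ?_
  rw [ContinuousLinearMap.star_eq_adjoint, ContinuousLinearMap.adjoint_inner_right]

theorem inner_matOp_nonneg {M : CStarMatrix (Fin n) (Fin n) (Op K)} (hM : 0 ≤ M)
    (x : PiLp 2 (fun _ : Fin n => K)) : 0 ≤ inner ℂ x (matOp M x) := by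
  obtain ⟨S, rfl⟩ := exists_star_mul_self hM
  rw [matOp_mul, inner_matOp_star]
  exact complex_inner_self_nonneg _

theorem nonneg_of_inner_matOp {M : CStarMatrix (Fin n) (Fin n) (Op K)}
    (h : ∀ x : PiLp 2 (fun _ : Fin n => K), 0 ≤ inner ℂ x (matOp M x)) : 0 ≤ M := by
  have hsa : IsSelfAdjoint M := by
    refine sub_eq_zero.1 (matOp_eq_zero ((inner_map_self_eq_zero _).1 fun x => ?_))
    have h1 : inner ℂ (matOp M x) x = inner ℂ x (matOp M x) := by
      rw [← inner_conj_symm]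
      exact (IsSelfAdjoint.of_nonneg (h x)).star_eq
    have h2 := inner_matOp_star M x x
    rw [← inner_conj_symm, matOp_sub, LinearMap.sub_apply, inner_sub_right, h2, h1, sub_self,
      map_zero]
  obtain ⟨N, S, hS, hMN, hN⟩ := exists_neg_part hsa
  have hSN : S * N = 0 := by
    refine matOp_eq_zero (LinearMap.ext fun x => ?_)
    have h1 := h (matOp N x)
    have h3 : N * N = star S * (S * N) := by
      nth_rewrite 1 [hS]
      rw [mul_assoc]
    rw [← matOp_mul, hMN, h3, matOp_neg, LinearMap.neg_apply, inner_neg_right, matOp_mul,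
      inner_matOp_star, ← matOp_mul] at h1
    exact inner_self_eq_zero.1 (le_antisymm (neg_nonneg.1 h1) (complex_inner_self_nonneg _))
  refine hN ?_
  nth_rewrite 1 [hS]
  rw [mul_assoc, hSN, mul_zero]

theorem cstarMatrix_nonneg_iff {M : CStarMatrix (Fin n) (Fin n) (Op K)} :
    0 ≤ M ↔ ∀ x : Fin n → K, 0 ≤ ∑ i, ∑ j, inner ℂ (x i) (M i j (x j)) := by
  refine ⟨fun h x => ?_, fun h => nonneg_of_inner_matOp fun x => ?_⟩
  · have := inner_matOp_nonneg h (WithLp.toLp 2 x)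
    rwa [inner_matOp] at this
  · rw [inner_matOp]
    exact h fun i => x i

theorem isPosMatrix_vecPredual (x : Fin n → K) :
    IsPosMatrix fun i j => vecPredual (x i) (x j) :=
  fun _ hA => cstarMatrix_nonneg_iff.1 hA x

theorem map_Lam_nonneg {M : CStarMatrix (Fin n) (Fin n) (Op K)} (hM : 0 ≤ M) :
    0 ≤ (M.map Lam : CStarMatrix (Fin n) (Fin n) (Op (HSp K))) := by
  refine cstarMatrix_nonneg_iff.2 fun f => ?_
  simp only [CStarMatrix.map_apply, L2.inner_def]
  rw [Finset.sum_congr rfl fun i _ =>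
      (integral_finsetSum _ fun j _ => L2.integrable_inner _ _).symm,
    ← integral_finsetSum _ fun i _ =>
      integrable_finsetSum _ fun j _ => L2.integrable_inner _ _]
  refine integral_nonneg_of_ae ?_
  have hae : ∀ᵐ x ∂halfLine, ∀ i j, (Lam (M i j) (f j) : ℝ → K) x =
      ((Real.exp (-x) : ℝ) : ℂ) • (M i j) (f j x) :=
    ae_all_iff.2 fun i => ae_all_iff.2 fun j => coeFn_Lam (M i j) (f j)
  filter_upwards [hae] with x hx
  simp only [hx, inner_smul_right, ← Finset.mul_sum]
  exact mul_nonneg (Complex.zero_le_real.2 (Real.exp_pos _).le)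
    (cstarMatrix_nonneg_iff.1 hM fun i => f i x)

end OperatorMatrix

/-! ### The projections `E(t, ∞)` -/

section Projections

variable {K : Type*} [NormedAddCommGroup K] [InnerProductSpace ℂ K]

theorem mulOp_comm (φ ψ : Lp ℂ ∞ halfLine) :
    (mulOp φ * mulOp ψ : Op (HSp K)) = mulOp ψ * mulOp φ := by
  ext1 f
  apply Lp.ext
  change (mulOp φ (mulOp ψ f) : ℝ → K) =ᵐ[halfLine] mulOp ψ (mulOp φ f)
  filter_upwards [coeFn_mulOp φ (mulOp ψ f), coeFn_mulOp ψ f, coeFn_mulOp ψ (mulOp φ f),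
    coeFn_mulOp φ f] with x a1 a2 a3 a4
  rw [a1, a2, a3, a4, smul_comm]

theorem cutFun_memLp (t : PosReal) :
    MemLp ((Set.Ioi t.1).indicator fun _ : ℝ => (1 : ℂ)) ∞ halfLine :=
  MemLp.indicator measurableSet_Ioi (memLp_top_const 1)

/-- Multiplication by the characteristic function of `(t, ∞)`. -/
def cutMul (t : PosReal) : Op (HSp K) := mulOp (cutFun_memLp t).toLp

theorem coeFn_cutMul (t : PosReal) (f : HSp K) :
    (cutMul t f : ℝ → K) =ᵐ[halfLine] (Set.Ioi t.1).indicator f := by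
  filter_upwards [coeFn_mulOp (cutFun_memLp t).toLp f, (cutFun_memLp t).coeFn_toLp] with x h1 h2
  rw [cutMul, h1, h2]
  by_cases hx : x ∈ Set.Ioi t.1 <;> simp [hx]

theorem cutMul_mul_shift (t : PosReal) : cutMul t * shift t = (shift t : Op (HSp K)) := by
  ext1 f
  apply Lp.ext
  change (cutMul t (shift t f) : ℝ → K) =ᵐ[halfLine] shift t f
  filter_upwards [coeFn_cutMul t (shift t f), coeFn_shift t f] with x h1 h2
  rw [h1]
  by_cases hx : x ∈ Set.Ioi t.1
  · simp [hx]
  · simp [hx, h2, shiftFun]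

theorem add_measurePreserving (t : PosReal) :
    MeasurePreserving (fun x : ℝ => x + t.1) halfLine (halfLine.restrict (Set.Ioi t.1)) := by
  have h := (measurePreserving_add_right (volume : Measure ℝ) t.1).restrict_preimage
    (measurableSet_Ioi (a := t.1))
  have h2 : (fun x : ℝ => x + t.1) ⁻¹' (Set.Ioi t.1) = Set.Ioi 0 := by
    ext x; simp
  rw [h2] at h
  rwa [Measure.restrict_restrict_of_subset (Set.Ioi_subset_Ioi (le_of_lt t.2))]

theorem exists_shift_eq_cutMul (t : PosReal) (f : HSp K) : ∃ h : HSp K, shift t h = cutMul t f := by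
  have hm : MemLp (fun x => f (x + t.1)) 2 halfLine :=
    ((Lp.memLp f).mono_measure Measure.restrict_le_self).comp_measurePreserving
      (add_measurePreserving t)
  refine ⟨hm.toLp, Lp.ext ?_⟩
  filter_upwards [coeFn_cutMul t f, coeFn_shift t hm.toLp, shiftFun_congr t hm.coeFn_toLp]
    with x h1 h2 h3
  rw [h1, h2, h3]
  by_cases hx : x ∈ Set.Ioi t.1 <;> simp [hx, shiftFun]

theorem norm_shift (t : PosReal) (f : HSp K) : ‖shift t f‖ = ‖f‖ := by
  change ‖(shiftFun_memLp t (Lp.memLp f)).toLp (shiftFun t f)‖ = ‖f‖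
  rw [Lp.norm_toLp, Lp.norm_def, shiftFun,
    eLpNorm_indicator_eq_eLpNorm_restrict measurableSet_Ioi]
  exact congrArg ENNReal.toReal
    (eLpNorm_comp_measurePreserving (Lp.aestronglyMeasurable f) (shift_measurePreserving t))

variable [CompleteSpace K]

theorem star_shift_mul_shift (t : PosReal) : star (shift t) * shift t = (1 : Op (HSp K)) :=
  (ContinuousLinearMap.norm_map_iff_adjoint_comp_self _).1 (norm_shift t)

theorem star_cutMul (t : PosReal) : star (cutMul t : Op (HSp K)) = cutMul t := by
  refine ContinuousLinearMap.ext fun g => ext_inner_left ℂ fun f => ?_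
  rw [ContinuousLinearMap.star_eq_adjoint, ContinuousLinearMap.adjoint_inner_right, L2.inner_def,
    L2.inner_def]
  refine integral_congr_ae ?_
  filter_upwards [coeFn_cutMul t f, coeFn_cutMul t g] with x h1 h2
  rw [h1, h2]
  by_cases hx : x ∈ Set.Ioi t.1 <;> simp [hx]

theorem proj_eq_cutMul (t : PosReal) : (proj t : Op (HSp K)) = cutMul t := by
  have h1 : cutMul t * proj t = (proj t : Op (HSp K)) := by
    rw [proj, ← mul_assoc, cutMul_mul_shift]
  have h2 : proj t * cutMul t = (cutMul t : Op (HSp K)) := by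
    ext1 f
    obtain ⟨h, hh⟩ := exists_shift_eq_cutMul t f
    change proj t (cutMul t f) = cutMul t f
    rw [← hh]
    exact congrArg (fun X : Op (HSp K) => shift t (X h)) (star_shift_mul_shift t)
  have h3 := congrArg star h1
  rw [star_mul, star_cutMul, proj, star_mul, star_star, ← proj, h2] at h3
  exact h3.symm

theorem proj_mul_proj_of_le {t r : PosReal} (h : t ≤ r) :
    proj t * proj r = (proj r : Op (HSp K)) := by
  rw [proj_eq_cutMul, proj_eq_cutMul]
  ext1 f
  apply Lp.ext
  change (cutMul t (cutMul r f) : ℝ → K) =ᵐ[halfLine] cutMul r f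
  filter_upwards [coeFn_cutMul t (cutMul r f), coeFn_cutMul r f] with x h1 h2
  rw [h1]
  by_cases hx : x ∈ Set.Ioi t.1
  · simp [hx]
  · have : x ∉ Set.Ioi r.1 := fun hr => hx (lt_of_le_of_lt (show t.1 ≤ r.1 from h) hr)
    rw [h2]
    simp [hx, this]

theorem star_proj (t : PosReal) : star (proj t : Op (HSp K)) = proj t := by
  rw [proj, star_mul, star_star]

theorem proj_mul_proj_of_le' {t r : PosReal} (h : t ≤ r) :
    proj r * proj t = (proj r : Op (HSp K)) := by
  have := congrArg star (proj_mul_proj_of_le (K := K) h)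
  rwa [star_mul, star_proj, star_proj] at this

theorem proj_mul_Dop (t : PosReal) : proj t * Dop K = Dop K * proj t := by
  rw [proj_eq_cutMul, Dop_eq, cutMul, mulOp_comm]

theorem norm_proj_apply_le (t : PosReal) (f : HSp K) : ‖proj t f‖ ≤ ‖f‖ := by
  rw [proj_eq_cutMul]
  refine Lp.norm_le_norm_of_ae_le ?_
  filter_upwards [coeFn_cutMul t f] with x h
  rw [h]
  exact norm_indicator_le_norm_self _ _

theorem norm_proj_le (t : PosReal) : ‖(proj t : Op (HSp K))‖ ≤ 1 :=
  ContinuousLinearMap.opNorm_le_bound _ zero_le_one fun f => by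
    rw [one_mul]; exact norm_proj_apply_le t f

/-- The sequence `1 / (n + 1)` in the index set of one-parameter families. -/
def cutSeq (n : ℕ) : PosReal := ⟨1 / ((n : ℝ) + 1), Set.mem_Ioi.2 Nat.one_div_pos_of_nat⟩

theorem tendsto_inner_proj (f g : HSp K) :
    Tendsto (fun n => inner ℂ f (proj (cutSeq n) g)) atTop (𝓝 (inner ℂ f g)) := by
  simp only [L2.inner_def]
  refine tendsto_integral_of_dominated_convergence (fun x => ‖inner ℂ (f x) (g x)‖)
    (fun n => (L2.integrable_inner _ _).aestronglyMeasurable)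
    (L2.integrable_inner f g).norm (fun n => ?_) ?_
  · filter_upwards [coeFn_cutMul (cutSeq n) g] with x h
    rw [proj_eq_cutMul, h]
    by_cases hx : x ∈ Set.Ioi (cutSeq n).1 <;> simp [hx]
  · have hae : ∀ᵐ x ∂halfLine, ∀ n,
        (cutMul (cutSeq n) g : ℝ → K) x = (Set.Ioi (cutSeq n).1).indicator g x :=
      ae_all_iff.2 fun n => coeFn_cutMul (cutSeq n) g
    filter_upwards [hae, ae_restrict_mem measurableSet_Ioi] with x h hx
    refine tendsto_const_nhds.congr' ?_
    filter_upwards [tendsto_one_div_add_atTop_nhds_zero_nat.eventually (gt_mem_nhds (Set.mem_Ioi.1 hx))] with n hn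
    have hn' : x ∈ Set.Ioi (cutSeq n).1 := hn
    rw [proj_eq_cutMul, h n, Set.indicator_of_mem hn']

theorem tendsto_proj (g : HSp K) :
    Tendsto (fun n => proj (cutSeq n) g) atTop (𝓝 g) := by
  rw [tendsto_iff_norm_sub_tendsto_zero]
  have h1 : Tendsto (fun n => ‖g‖ ^ 2 - RCLike.re (inner ℂ g (proj (cutSeq n) g))) atTop
      (𝓝 (‖g‖ ^ 2 - RCLike.re (inner ℂ g g))) :=
    tendsto_const_nhds.sub ((RCLike.continuous_re.tendsto _).comp (tendsto_inner_proj g g))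
  rw [inner_self_eq_norm_sq, sub_self] at h1
  have h2 : ∀ n, ‖proj (cutSeq n) g - g‖ ^ 2 =
      ‖g‖ ^ 2 - RCLike.re (inner ℂ g (proj (cutSeq n) g)) := fun n => by
    have hp : proj (cutSeq n) (proj (cutSeq n) g) = proj (cutSeq n) g :=
      congrArg (fun X : Op (HSp K) => X g) (proj_mul_proj_of_le (le_refl (cutSeq n)))
    have hs : inner ℂ (proj (cutSeq n) g) (proj (cutSeq n) g) = inner ℂ g (proj (cutSeq n) g) := by
      rw [← ContinuousLinearMap.adjoint_inner_right, ← ContinuousLinearMap.star_eq_adjoint,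
        star_proj, hp]
    rw [norm_sub_sq (𝕜 := ℂ), ← inner_self_eq_norm_sq (𝕜 := ℂ), hs, ← inner_conj_symm,
      RCLike.conj_re]
    ring
  simp only [← h2] at h1
  have h3 := (Real.continuous_sqrt.tendsto 0).comp h1
  rw [Real.sqrt_zero] at h3
  exact h3.congr fun n => Real.sqrt_sq (norm_nonneg _)

end Projections

section NormalConvergence

theorem tendsto_normal {H : Type*} [NormedAddCommGroup H] [InnerProductSpace ℂ H]
    {ι : Type*} {l : Filter ι} {X : ι → Op H} {Y : Op H} {C : ℝ} (hX : ∀ i, ‖X i‖ ≤ C)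
    (hY : ‖Y‖ ≤ C) (h : ∀ x y, Tendsto (fun i => inner ℂ x (X i y)) l (𝓝 (inner ℂ x (Y y))))
    {ℓ : Op H →L[ℂ] ℂ} (hℓ : ℓ ∈ normalFunctionals H) :
    Tendsto (fun i => ℓ (X i)) l (𝓝 (ℓ Y)) := by
  have hspan : ∀ σ ∈ Submodule.span ℂ (Set.range fun p : H × H => vectorFunctional p.1 p.2),
      Tendsto (fun i => σ (X i)) l (𝓝 (σ Y)) := by
    intro σ hσ
    induction hσ using Submodule.span_induction with
    | mem σ hσ =>
      obtain ⟨p, rfl⟩ := hσ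
      exact h p.1 p.2
    | zero => exact tendsto_const_nhds
    | add σ τ _ _ h1 h2 => exact h1.add h2
    | smul a σ _ h1 => exact h1.const_smul a
  have hC : 0 ≤ C := (norm_nonneg Y).trans hY
  rw [Metric.tendsto_nhds]
  intro ε hε
  have hδ : 0 < ε / (3 * (C + 1)) := by positivity
  obtain ⟨σ, hσ, hσd⟩ := (Metric.mem_closure_iff (α := Op H →L[ℂ] ℂ)).1 hℓ _ hδ
  replace hσd : ‖ℓ - σ‖ < ε / (3 * (C + 1)) := (dist_eq_norm ℓ σ).symm.trans_lt hσd
  have hbd : ∀ Z : Op H, ‖Z‖ ≤ C → ‖ℓ Z - σ Z‖ < ε / 3 := fun Z hZ => by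
    have h1 : ‖(ℓ - σ) Z‖ ≤ ε / (3 * (C + 1)) * C :=
      ((ℓ - σ).le_opNorm Z).trans (mul_le_mul hσd.le hZ (norm_nonneg _) hδ.le)
    refine lt_of_le_of_lt h1 ?_
    rw [div_mul_eq_mul_div, div_lt_div_iff₀ (by positivity) (by norm_num)]
    nlinarith
  filter_upwards [Metric.tendsto_nhds.1 (hspan σ hσ) (ε / 3) (by positivity)] with i hi
  rw [dist_eq_norm] at hi ⊢
  have e : ℓ (X i) - ℓ Y = (ℓ (X i) - σ (X i)) + (σ (X i) - σ Y) - (ℓ Y - σ Y) := by ring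
  rw [e]
  have := norm_sub_le ((ℓ (X i) - σ (X i)) + (σ (X i) - σ Y)) (ℓ Y - σ Y)
  have := norm_add_le (ℓ (X i) - σ (X i)) (σ (X i) - σ Y)
  linarith [hbd _ (hX i), hbd _ hY]

end NormalConvergence

/-! ### Continuity of `q`-weight maps -/

section Weights

variable {K : Type*} [NormedAddCommGroup K] [InnerProductSpace ℂ K] [CompleteSpace K]

instance : CompleteSpace (Predual K) :=
  (Submodule.isClosed_topologicalClosure
    (Submodule.span ℂ (Set.range fun p : K × K => vectorFunctional p.1 p.2))).completeSpace_coe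

theorem norm_LamHat_le (η : Predual (HSp K)) : ‖LamHat η‖ ≤ ‖η‖ := by
  refine ContinuousLinearMap.opNorm_le_bound _ (norm_nonneg η) fun A => ?_
  exact ((Predual.toDual η).le_opNorm (Lam A)).trans
    (mul_le_mul_of_nonneg_left (norm_Lam_le A) (norm_nonneg η))

theorem cut_eq_compress {T : boundaryAlgebra K} {A : Op (HSp K)} (hA : compress K A = T)
    (t : PosReal) : cut t (T : Op (HSp K)) = compress K (sandwich (proj t) (proj t) A) := by
  subst hA
  refine Subtype.ext ?_
  change proj t * ((Dop K * (A * Dop K)) * proj t) = Dop K * ((proj t * (A * proj t)) * Dop K)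
  simp only [mul_assoc]
  rw [proj_mul_Dop]
  simp only [← mul_assoc]
  rw [proj_mul_Dop]

theorem norm_sandwich_proj_le (t : PosReal) (A : Op (HSp K)) :
    ‖sandwich (proj t) (proj t) A‖ ≤ ‖A‖ := by
  rw [sandwich_apply]
  calc ‖proj t * (A * proj t)‖ ≤ ‖(proj t : Op (HSp K))‖ * (‖A‖ * ‖(proj t : Op (HSp K))‖) :=
        (norm_mul_le _ _).trans (mul_le_mul_of_nonneg_left (norm_mul_le _ _) (norm_nonneg _))
    _ ≤ 1 * (‖A‖ * 1) := by
        gcongr <;> exact norm_proj_le t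
    _ = ‖A‖ := by ring

theorem tendsto_truncate (μ : BoundaryWeight K) (T : boundaryAlgebra K) :
    Tendsto (fun n => truncate (cutSeq n) μ (T : Op (HSp K))) atTop (𝓝 (μ.1 T)) := by
  obtain ⟨A, hA⟩ : ∃ A, compress K A = T := LinearMap.surjective_rangeRestrict _ T
  obtain ⟨ℓ, hℓ, h⟩ := μ.2
  have h1 : ∀ n, truncate (cutSeq n) μ (T : Op (HSp K)) =
      ℓ (sandwich (proj (cutSeq n)) (proj (cutSeq n)) A) := fun n => by
    rw [← h, ← cut_eq_compress hA]
    rfl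
  simp only [h1]
  rw [← hA, h]
  refine tendsto_normal (fun n => norm_sandwich_proj_le _ A) le_rfl (fun x y => ?_) hℓ
  have h2 : ∀ n, inner ℂ x ((sandwich (proj (cutSeq n)) (proj (cutSeq n)) A) y) =
      inner ℂ (proj (cutSeq n) x) (A (proj (cutSeq n) y)) := fun n => by
    rw [← ContinuousLinearMap.adjoint_inner_right, ← ContinuousLinearMap.star_eq_adjoint,
      star_proj]
    rfl
  simp only [h2]
  exact (tendsto_proj x).inner ((A.continuous.tendsto y).comp (tendsto_proj y))

variable {ω : BoundaryWeightMap K}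

theorem inverse_resolventMap (hω : IsQWeightMap ω) (t : PosReal) :
    Ring.inverse (resolventMap ω t) = 1 - LamHat ∘ₗ piHat ω t := by
  have h := Ring.mul_inverse_cancel _ (hω.invertible t)
  have h2 : resolventMap ω t * Ring.inverse (resolventMap ω t) =
      Ring.inverse (resolventMap ω t) + LamHat ∘ₗ piHat ω t := by
    nth_rewrite 1 [resolventMap]
    rw [add_mul, one_mul]
    rfl
  rw [← h, h2, add_sub_cancel_right]

theorem piHat_resolventMap (hω : IsQWeightMap ω) (t : PosReal) :
    piHat ω t ∘ₗ resolventMap ω t = trunc ω t := by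
  have h := Ring.inverse_mul_cancel _ (hω.invertible t)
  change trunc ω t ∘ₗ (Ring.inverse (resolventMap ω t) * resolventMap ω t) = _
  rw [h]
  rfl

theorem trunc_eq_add_left (hω : IsQWeightMap ω) (t : PosReal) (ρ : Predual K) :
    trunc ω t ρ = piHat ω t ρ + piHat ω t (LamHat (trunc ω t ρ)) := by
  rw [← map_add]
  exact (LinearMap.congr_fun (piHat_resolventMap hω t) ρ).symm

theorem trunc_eq_add_right (hω : IsQWeightMap ω) (t : PosReal) (ρ : Predual K) :
    trunc ω t ρ = piHat ω t ρ + trunc ω t (LamHat (piHat ω t ρ)) := by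
  have h : piHat ω t ρ = trunc ω t (ρ - LamHat (piHat ω t ρ)) :=
    congrArg (fun f : Module.End ℂ (Predual K) => trunc ω t (f ρ)) (inverse_resolventMap hω t)
  rw [map_sub] at h
  exact (sub_eq_iff_eq_add.1 h.symm)

theorem exists_norm_trunc_le (hω : IsQWeightMap ω) (t : PosReal) :
    ∃ C : ℝ, ∀ ρ, ‖trunc ω t ρ‖ ≤ C * ‖ρ‖ := by
  let e : Predual K ≃ₗ[ℂ] Predual K := LinearEquiv.ofLinearMap
    (Ring.inverse (resolventMap ω t)) (resolventMap ω t)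
    (Ring.inverse_mul_cancel _ (hω.invertible t)) (Ring.mul_inverse_cancel _ (hω.invertible t))
  have he : Continuous e := by
    refine AddMonoidHomClass.continuous_of_bound e 2 fun ρ => ?_
    change ‖Ring.inverse (resolventMap ω t) ρ‖ ≤ 2 * ‖ρ‖
    rw [inverse_resolventMap hω]
    change ‖ρ - LamHat (piHat ω t ρ)‖ ≤ 2 * ‖ρ‖
    linarith [norm_sub_le ρ (LamHat (piHat ω t ρ)), norm_LamHat_le (piHat ω t ρ),
      hω.contraction_piHat t ρ]
  let f := (e.toContinuousLinearEquivOfContinuous he).symm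
  refine ⟨‖(f : Predual K →L[ℂ] Predual K)‖, fun ρ => ?_⟩
  rw [← piHat_resolventMap hω]
  exact (hω.contraction_piHat t _).trans ((f : Predual K →L[ℂ] Predual K).le_opNorm ρ)

theorem exists_norm_apply_le (hω : IsQWeightMap ω) (T : boundaryAlgebra K) :
    ∃ C : ℝ, ∀ ρ, ‖(ω ρ).1 T‖ ≤ C * ‖ρ‖ := by
  choose C hC using fun n => exists_norm_trunc_le hω (cutSeq n)
  let g : ℕ → Predual K →L[ℂ] ℂ := fun n => LinearMap.mkContinuous
    (LinearMap.applyₗ (T : Op (HSp K)) ∘ₗ ContinuousLinearMap.coeLM ℂ ∘ₗ Predual.toDual ∘ₗ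
      trunc ω (cutSeq n)) (C n * ‖(T : Op (HSp K))‖) fun ρ => by
    rw [mul_right_comm]
    exact ((Predual.toDual (trunc ω (cutSeq n) ρ)).le_opNorm _).trans
      (mul_le_mul_of_nonneg_right (hC n ρ) (norm_nonneg _))
  have hg : ∀ ρ, Tendsto (fun n => g n ρ) atTop (𝓝 ((ω ρ).1 T)) := fun ρ =>
    tendsto_truncate (ω ρ) T
  obtain ⟨C', hC'⟩ := banach_steinhaus (g := g) fun ρ => by
    obtain ⟨M, hM⟩ := (hg ρ).norm.bddAbove_range
    exact ⟨M, fun n => hM ⟨n, rfl⟩⟩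
  refine ⟨C', fun ρ => le_of_tendsto (hg ρ).norm (Eventually.of_forall fun n => ?_)⟩
  exact (g n).le_of_opNorm_le (hC' n) ρ

theorem dualized_spec (hω : IsQWeightMap ω) (ρ : Predual K) (T : boundaryAlgebra K) :
    ρ (dualized ω T) = (ω ρ).1 T :=
  dualMap_spec _ (exists_norm_apply_le hω) ρ T

theorem apply_dualized_cut (hω : IsQWeightMap ω) (t : PosReal) (ρ : Predual K)
    (A : Op (HSp K)) : ρ (dualized ω (cut t A)) = trunc ω t ρ A :=
  dualized_spec hω ρ (cut t A)

theorem tendsto_dualized_cut (hω : IsQWeightMap ω) (ρ : Predual K) (T : boundaryAlgebra K) :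
    Tendsto (fun n => ρ (dualized ω (cut (cutSeq n) (T : Op (HSp K))))) atTop
      (𝓝 (ρ (dualized ω T))) := by
  simp only [apply_dualized_cut hω]
  rw [dualized_spec hω]
  exact tendsto_truncate (ω ρ) T

theorem genRep_eq (hω : IsQWeightMap ω) (t : PosReal) (A : Op (HSp K)) :
    genRep ω t A = dualized ω (cut t (A - Lam (genRep ω t A))) := by
  refine op_ext fun ρ => ?_
  have h : trunc ω t ρ A = ρ (genRep ω t A) + trunc ω t ρ (Lam (genRep ω t A)) := by
    nth_rewrite 1 [trunc_eq_add_left hω]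
    rw [genRep_spec hω]
    exact congrArg ((piHat ω t ρ) A + ·) (genRep_spec hω t (LamHat (trunc ω t ρ)) A).symm
  rw [apply_dualized_cut hω, map_sub, h, add_sub_cancel_right]

theorem dualized_cut_eq (hω : IsQWeightMap ω) (t : PosReal) (A : Op (HSp K)) :
    dualized ω (cut t A) = genRep ω t A + genRep ω t (Lam (dualized ω (cut t A))) := by
  refine op_ext fun ρ => ?_
  rw [map_add, apply_dualized_cut hω, genRep_spec hω, genRep_spec hω, trunc_eq_add_right hω]
  exact congrArg ((piHat ω t ρ) A + ·) (apply_dualized_cut hω t (LamHat (piHat ω t ρ)) A).symm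

theorem cut_cut {t r : PosReal} (h : t ≤ r) (A : Op (HSp K)) :
    cut t (cut r A : Op (HSp K)) = cut r A := by
  refine Subtype.ext ?_
  change proj t * ((proj r * (A * proj r)) * proj t) = proj r * (A * proj r)
  simp only [mul_assoc]
  rw [proj_mul_proj_of_le' h, ← mul_assoc, proj_mul_proj_of_le h]

theorem tendsto_genRep_cut (hspine : IsNormalSpine ω 0) (r : PosReal) (A : Op (HSp K))
    (x y : K) :
    Tendsto (fun t => inner ℂ x (genRep ω t (cut r A : Op (HSp K)) y)) atBot (𝓝 0) := by
  have h := hspine.2 r (star (shift r) * A * shift r) (vecPredual y y) fun B hB =>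
    ((ContinuousLinearMap.nonneg_iff_isPositive B).1 hB).inner_nonneg_right y
  have hc : shift r * (star (shift r) * A * shift r) * star (shift r) =
      (cut r A : Op (HSp K)) := by
    change _ = proj r * (A * proj r)
    simp only [proj, mul_assoc]
  rw [hc] at h
  have h1 : ∀ t, vecPredual y y (star (genRep ω t (cut r A : Op (HSp K)) -
      (0 : Op (HSp K) →ₗ[ℂ] Op K) (cut r A)) * (genRep ω t (cut r A : Op (HSp K)) -
      (0 : Op (HSp K) →ₗ[ℂ] Op K) (cut r A))) =
      ((‖genRep ω t (cut r A : Op (HSp K)) y‖ ^ 2 : ℝ) : ℂ) := fun t => by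
    rw [LinearMap.zero_apply, sub_zero]
    change inner ℂ y ((star (genRep ω t (cut r A : Op (HSp K)))) (genRep ω t (cut r A) y)) = _
    rw [ContinuousLinearMap.star_eq_adjoint, ContinuousLinearMap.adjoint_inner_right,
      inner_self_eq_norm_sq_to_K]
    push_cast
    rfl
  simp only [h1] at h
  have h2 : Tendsto (fun t => ‖genRep ω t (cut r A : Op (HSp K)) y‖ ^ 2) atBot (𝓝 0) := by
    exact (Complex.continuous_re.tendsto _).comp h
  have h3 : Tendsto (fun t => ‖genRep ω t (cut r A : Op (HSp K)) y‖) atBot (𝓝 0) := by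
    have := (Real.continuous_sqrt.tendsto 0).comp h2
    rw [Real.sqrt_zero] at this
    exact this.congr fun t => Real.sqrt_sq (norm_nonneg _)
  refine squeeze_zero_norm (fun t => norm_inner_le_norm x _) ?_
  simpa using h3.const_mul ‖x‖

end Weights

/-! ### Finite-dimensional spaces of operators -/

section FiniteDimensional

variable {K : Type*} [NormedAddCommGroup K] [InnerProductSpace ℂ K] [CompleteSpace K]

theorem exists_predual_eq_on (F : Submodule ℂ (Op K)) [FiniteDimensional ℂ F] (f : F →ₗ[ℂ] ℂ) :
    ∃ ρ : Predual K, ∀ v : F, ρ (v : Op K) = f v := by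
  let Φ : Predual K →ₗ[ℂ] Module.Dual ℂ F :=
    F.subtype.dualMap ∘ₗ ContinuousLinearMap.coeLM ℂ ∘ₗ Predual.toDual
  have hco : (LinearMap.range Φ).dualCoannihilator = ⊥ := by
    rw [eq_bot_iff]
    intro v hv
    rw [Submodule.mem_dualCoannihilator] at hv
    refine Subtype.ext (op_ext fun ρ => ?_)
    rw [Submodule.coe_zero, map_zero]
    exact hv (Φ ρ) ⟨ρ, rfl⟩
  have htop : LinearMap.range Φ = ⊤ := by
    rw [← Subspace.dualCoannihilator_dualAnnihilator_eq (W := LinearMap.range Φ), hco,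
      Submodule.dualAnnihilator_bot]
  obtain ⟨ρ, hρ⟩ := LinearMap.range_eq_top.1 htop f
  exact ⟨ρ, fun v => LinearMap.congr_fun hρ v⟩

theorem mem_of_tendsto_predual {F : Submodule ℂ (Op K)} [FiniteDimensional ℂ F] {ι : Type*}
    {l : Filter ι} [l.NeBot] {X : ι → Op K} {Y : Op K} (hX : ∀ i, X i ∈ F)
    (h : ∀ ρ : Predual K, Tendsto (fun i => ρ (X i)) l (𝓝 (ρ Y))) : Y ∈ F := by
  by_contra hY
  let G : Submodule ℂ (Op K) := F ⊔ Submodule.span ℂ {Y}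
  have hYG : Y ∈ G := Submodule.mem_sup_right (Submodule.mem_span_singleton_self Y)
  have hFG : F ≤ G := le_sup_left
  have hY' : (⟨Y, hYG⟩ : G) ∉ F.comap G.subtype := hY
  obtain ⟨f, hfY, hfF⟩ := Submodule.exists_le_ker_of_notMem hY'
  obtain ⟨ρ, hρ⟩ := exists_predual_eq_on G f
  have h1 : ∀ i, ρ (X i) = 0 := fun i => by
    rw [hρ ⟨X i, hFG (hX i)⟩]
    exact hfF (show (⟨X i, hFG (hX i)⟩ : G) ∈ F.comap G.subtype from hX i)
  have h2 := h ρ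
  simp only [h1] at h2
  exact hfY ((hρ ⟨Y, hYG⟩).symm.trans (tendsto_nhds_unique h2 tendsto_const_nhds))

end FiniteDimensional

/-! ### Cluster points of the net -/

section Cluster

variable {K : Type*} [NormedAddCommGroup K] [InnerProductSpace ℂ K] [CompleteSpace K]

theorem CMap.tendsto_iff {ι : Type*} {l : Filter ι} {F : ι → CMap K} {L : CMap K} :
    Tendsto F l (𝓝 L) ↔ ∀ (ρ : Predual K) (A : Op K),
      Tendsto (fun i => ρ ((F i).toMap A)) l (𝓝 (ρ (L.toMap A))) := by
  rw [nhds_induced, tendsto_comap_iff, tendsto_pi_nhds]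
  exact ⟨fun h ρ A => h (ρ, A), fun h p => h p.1 p.2⟩

theorem norm_op_le_of_predual {A : Op K} {C : ℝ} (hC : 0 ≤ C)
    (h : ∀ ρ : Predual K, ‖ρ A‖ ≤ C * ‖ρ‖) : ‖A‖ ≤ C := by
  refine ContinuousLinearMap.opNorm_le_of_re_inner_le hC fun x y hx hy => ?_
  have h1 : ‖inner ℂ y (A x)‖ ≤ C * ‖vecPredual y x‖ := h (vecPredual y x)
  have h2 : ‖vecPredual y x‖ ≤ ‖y‖ * ‖x‖ := norm_vectorFunctional_le y x
  rw [hx, hy, one_mul] at h2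
  refine (RCLike.re_le_norm _).trans ?_
  rw [norm_inner_symm]
  exact h1.trans (mul_le_of_le_one_right hC h2)

theorem CMap.exists_tendsto {ι : Type*} (𝒰 : Ultrafilter ι) (F : ι → CMap K) :
    ∃ L : CMap K, Tendsto F 𝒰 (𝓝 L) := by
  have hbd : ∀ (ρ : Predual K) (A : Op K) (i : ι), ‖ρ ((F i).toMap A)‖ ≤ ‖A‖ * ‖ρ‖ := by
    intro ρ A i
    have h1 : ‖(F i).toMap A‖ ≤ ‖A‖ := by
      simpa using (F i).toMap.le_of_opNorm_le (F i).norm_le A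
    rw [mul_comm]
    exact ((Predual.toDual ρ).le_opNorm _).trans (mul_le_mul_of_nonneg_left h1 (norm_nonneg ρ))
  have hlim : ∀ (ρ : Predual K) (A : Op K), ∃ z : ℂ,
      Tendsto (fun i => ρ ((F i).toMap A)) 𝒰 (𝓝 z) := by
    intro ρ A
    obtain ⟨z, -, hz⟩ := (isCompact_closedBall (0 : ℂ) (‖A‖ * ‖ρ‖)).ultrafilter_le_nhds
      (𝒰.map fun i => ρ ((F i).toMap A)) (by
        rw [le_principal_iff]
        exact Filter.mem_map.2
          (Eventually.of_forall fun i => mem_closedBall_zero_iff.2 (hbd ρ A i)))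
    exact ⟨z, hz⟩
  choose z hz using hlim
  have hzb : ∀ ρ A, ‖z ρ A‖ ≤ ‖A‖ * ‖ρ‖ := fun ρ A =>
    le_of_tendsto (hz ρ A).norm (Eventually.of_forall (hbd ρ A))
  have hop : ∀ A, ∃ B : Op K, ∀ ρ : Predual K, ρ B = z ρ A := fun A =>
    exists_op
      { toFun := fun ρ => z ρ A
        map_add' := fun ρ σ => tendsto_nhds_unique (hz (ρ + σ) A) ((hz ρ A).add (hz σ A))
        map_smul' := fun c ρ => tendsto_nhds_unique (hz (c • ρ) A) ((hz ρ A).const_smul c) }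
      ‖A‖ fun ρ => hzb ρ A
  choose B hB using hop
  let L : Op K →L[ℂ] Op K := LinearMap.mkContinuous
    { toFun := B
      map_add' := fun A A' => op_ext fun ρ => by
        rw [map_add, hB, hB, hB]
        refine tendsto_nhds_unique (hz ρ (A + A')) (((hz ρ A).add (hz ρ A')).congr fun i => ?_)
        rw [map_add, map_add]
      map_smul' := fun c A => op_ext fun ρ => by
        rw [RingHom.id_apply, map_smul, hB, hB]
        refine tendsto_nhds_unique (hz ρ (c • A)) (((hz ρ A).const_smul c).congr fun i => ?_)
        rw [map_smul, map_smul] } 1 fun A => by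
      rw [one_mul]
      refine norm_op_le_of_predual (norm_nonneg A) fun ρ => ?_
      exact (congrArg norm (hB A ρ)).trans_le (hzb ρ A)
  refine ⟨⟨L, LinearMap.mkContinuous_norm_le _ zero_le_one _⟩, CMap.tendsto_iff.2 fun ρ A => ?_⟩
  have h1 : ρ (L A) = z ρ A := hB A ρ
  change Tendsto _ _ (𝓝 (ρ (L A)))
  rw [h1]
  exact hz ρ A

variable {ω : BoundaryWeightMap K}

theorem inner_genRep_Lam_nonneg (hω : IsQWeightMap ω) (t : PosReal) {n : ℕ}
    {M : CStarMatrix (Fin n) (Fin n) (Op K)} (hM : 0 ≤ M) (x : Fin n → K) :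
    0 ≤ ∑ i, ∑ j, inner ℂ (x i) (genRep ω t (Lam (M i j)) (x j)) := by
  have h := hω.cp_piHat t n _ (isPosMatrix_vecPredual x) _ (map_Lam_nonneg hM)
  refine h.trans_eq (Finset.sum_congr rfl fun i _ => Finset.sum_congr rfl fun j _ => ?_)
  exact (genRep_spec hω t (vecPredual (x i) (x j)) (Lam (M i j))).symm

theorem isCP_of_tendsto (hω : IsQWeightMap ω) {l : Filter PosReal} [l.NeBot] {L : CMap K}
    (hL : Tendsto (bwNet hω) l (𝓝 L)) : IsCP (L.toMap : Op K →ₗ[ℂ] Op K) := by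
  refine ⟨⟨L.toMap, fun n M hM => cstarMatrix_nonneg_iff.2 fun x => ?_⟩, rfl⟩
  have h : Tendsto (fun t => ∑ i, ∑ j, inner ℂ (x i) (genRep ω t (Lam (M i j)) (x j))) l
      (𝓝 (∑ i, ∑ j, inner ℂ (x i) (L.toMap (M i j) (x j)))) :=
    tendsto_finsetSum _ fun i _ => tendsto_finsetSum _ fun j _ =>
      CMap.tendsto_iff.1 hL (vecPredual (x i) (x j)) (M i j)
  exact ge_of_tendsto' h fun t => inner_genRep_Lam_nonneg hω t hM x

theorem apply_dualized_of_tendsto (hω : IsQWeightMap ω) (hfin : HasFiniteRangeRank ω)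
    (hspine : IsNormalSpine ω 0) {l : Filter PosReal} [l.NeBot] (hl : l ≤ atBot) {L : CMap K}
    (hL : Tendsto (bwNet hω) l (𝓝 L)) (T : boundaryAlgebra K) :
    L.toMap (dualized ω T) = dualized ω T := by
  have hcut : ∀ (r : PosReal) (A : Op (HSp K)),
      L.toMap (dualized ω (cut r A)) = dualized ω (cut r A) := by
    intro r A
    refine ContinuousLinearMap.ext fun y => ext_inner_left ℂ fun x => ?_
    have h1 := CMap.tendsto_iff.1 hL (vecPredual x y) (dualized ω (cut r A))
    have h2 : Tendsto (fun t => inner ℂ x (dualized ω (cut r A) y) -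
        inner ℂ x (genRep ω t (cut r A : Op (HSp K)) y)) l
        (𝓝 (inner ℂ x (dualized ω (cut r A) y) - 0)) :=
      tendsto_const_nhds.sub ((tendsto_genRep_cut hspine r A x y).mono_left hl)
    rw [sub_zero] at h2
    refine tendsto_nhds_unique h1 (h2.congr' ?_)
    filter_upwards [hl (eventually_le_atBot r)] with t ht
    have h3 := dualized_cut_eq hω t (cut r A : Op (HSp K))
    rw [cut_cut ht] at h3
    change _ = inner ℂ x (genRep ω t (Lam (dualized ω (cut r A))) y)
    nth_rewrite 1 [h3]
    rw [add_apply, inner_add_right, add_sub_cancel_left]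
  have : FiniteDimensional ℂ (LinearMap.range (dualized ω)) := hfin
  refine op_ext fun ρ => ?_
  obtain ⟨σ, hσ⟩ := exists_predual_eq_on (LinearMap.range (dualized ω))
    ((Predual.toDual ρ ∘L L.toMap : Op K →ₗ[ℂ] ℂ) ∘ₗ (LinearMap.range (dualized ω)).subtype)
  have hσ' : ∀ S, σ (dualized ω S) = ρ (L.toMap (dualized ω S)) := fun S =>
    hσ ⟨dualized ω S, S, rfl⟩
  have h1 := tendsto_dualized_cut hω σ T
  simp only [hσ', hcut] at h1
  exact tendsto_nhds_unique h1 (tendsto_dualized_cut hω ρ T)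

theorem isBoundaryExpectation_of_tendsto (hω : IsQWeightMap ω) (hne : ω ≠ 0)
    (hfin : HasFiniteRangeRank ω) (hspine : IsNormalSpine ω 0) {l : Filter PosReal} [l.NeBot]
    (hl : l ≤ atBot) {L : CMap K} (hL : Tendsto (bwNet hω) l (𝓝 L)) :
    IsBoundaryExpectation ω L.toMap := by
  have hfix := apply_dualized_of_tendsto hω hfin hspine hl hL
  have : FiniteDimensional ℂ (LinearMap.range (dualized ω)) := hfin
  have hmem : ∀ A, L.toMap A ∈ LinearMap.range (dualized ω) := fun A =>
    mem_of_tendsto_predual (X := fun t => (bwNet hω t).toMap A)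
      (fun t => ⟨_, (genRep_eq hω t (Lam A)).symm⟩) fun ρ => CMap.tendsto_iff.1 hL ρ A
  refine ⟨isCP_of_tendsto hω hL, LinearMap.ext hfix, le_antisymm ?_ ?_, ?_, ?_⟩
  · rintro _ ⟨A, rfl⟩
    exact hmem A
  · rintro _ ⟨T, rfl⟩
    exact ⟨_, hfix T⟩
  · ext1 A
    obtain ⟨T, hT⟩ := hmem A
    change L.toMap (L.toMap A) = L.toMap A
    rw [← hT, hfix]
  · refine le_antisymm L.norm_le ?_
    obtain ⟨T, hT⟩ : ∃ T, dualized ω T ≠ 0 := by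
      by_contra! h
      refine hne (LinearMap.ext fun ρ => Subtype.ext (LinearMap.ext fun T => ?_))
      rw [← dualized_spec hω, h, map_zero]
      rfl
    have h1 := L.toMap.le_opNorm (dualized ω T)
    rw [hfix] at h1
    exact le_of_mul_le_mul_right (by rwa [one_mul]) (norm_pos_iff.2 hT)

end Cluster

end QWeight

end

theorem mainTheorem7 {K : Type*} [NormedAddCommGroup K] [InnerProductSpace ℂ K] [CompleteSpace K]
    [TopologicalSpace.SeparableSpace K]
    (ω : QWeight.BoundaryWeightMap K) (hω : QWeight.IsQWeightMap ω) (hne : ω ≠ 0)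
    (hfin : QWeight.HasFiniteRangeRank ω) (hspine : QWeight.IsNormalSpine ω 0) :
    (∃ L : QWeight.CMap K, MapClusterPt L Filter.atBot (QWeight.bwNet hω)) ∧
      ∀ L : QWeight.CMap K, MapClusterPt L Filter.atBot (QWeight.bwNet hω) →
        QWeight.IsBoundaryExpectation ω L.toMap := by
  refine ⟨?_, fun L hL => ?_⟩
  · obtain ⟨L, hL⟩ := QWeight.CMap.exists_tendsto (Ultrafilter.of atBot) (QWeight.bwNet hω)
    exact ⟨L, mapClusterPt_iff_ultrafilter.2 ⟨_, Ultrafilter.of_le _, hL⟩⟩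
  · obtain ⟨U, hU, hUL⟩ := mapClusterPt_iff_ultrafilter.1 hL
    exact QWeight.isBoundaryExpectation_of_tendsto hω hne hfin hspine hU hUL
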